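/- **Setting.** Let $\Omega\subset\mathbb R^n$ be a domain (nonempty, open, connected). A curve in $\Omega$ is a rectifiable curve, parametrized by arc length; $\ell(\gamma)$ is its length. For a continuous $\rho:\Omega\to(0,\infty)$ put $\ell_\rho(\gamma)=\int_\gamma\rho\,|dz|$ and let $d_\rho(x,y)=\inf_\gamma \ell_\rho(\gamma)$, the infimum over curves in $\Omega$ joining $x$ to $y$. For $\rho\equiv1$ this is the internal metric $d$. Let $\overline\Omega^{\rho}$ and $\overline\Omega^{d}$ be the metric completions of $(\Omega,d_\rho)$ and $(\Omega,d)$, and put $\partial_\rho\Omega=\overline\Omega^{\rho}\setminus\Omega$, $\partial_d\Omega=\overline\Omega^{d}\setminus\Omega$. For $x\in\Omega$ let $d(x)$ be the Euclidean distance from $x$ to the boundary of $\Omega$. The function $\rho$ is a *density* if $\partial_\rho\Omega\ne\emptyset$ and, for all sequences $(x_i)$ in $\Omega$: if $(x_i)$ converges in $\overline\Omega^{\rho}$, then it converges in $\overline\Omega^{d}$; and if $(x_i)$ converges in $\overline\Omega^{d}$, then it has at most one accumulation point in $\partial_\rho\Omega$. For a density the identity of $\Omega$ extends to a continuous injection $\overline\Omega^{\rho}\to\overline\Omega^{d}$,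 through which $\partial_\rho\Omega$ is regarded as a subset of $\partial_d\Omega$. $\Omega$ is a *John domain* if for some $0<\alpha\le1$ there is $x_0\in\Omega$ such that every $x\in\Omega$ can be joined to $x_0$ by a curve $\gamma$ in $\Omega$, starting at $x$, with $d(\gamma(t))\ge\alpha t$ for all $0\le t\le\ell(\gamma)$. *Assumption (G).* For each $x\in\partial_\rho\Omega$ and each $\varepsilon>0$ there is $r>0$ such that every $y\in\overline\Omega^{\rho}$ with $y\neq x$ and $d_\rho(x,y)<r$ can be joined to $x$ by a curve $\gamma$ of finite length, lying in $\Omega$ except possibly for its endpoints, with $\sup_{z\in\gamma}d(z)\ge d(x,y)^{1+\varepsilon}$ and $\ell_\rho(\gamma)\le d_\rho(x,y)^{1-\varepsilon}$. For $x\in\partial_d\Omega$ let $$i^-(x)=\liminf_{y\to x,\ y\in\Omega}\frac{\log\rho(y)}{\log d(y)},\qquad i^+(x)=\limsup_{y\to x,\ y\in\Omega}\frac{\log\rho(y)}{\log d(y)}\qquad(\text{values in }[-\infty,\infty]),$$ where $y\to x$ in the internal metric. In a metric space $X$, $\dim_X$ is the Hausdorff dimension and $\operatorname{Dim}_X$ the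 packing dimension, $\operatorname{Dim}_X(A)=\sup\{s\ge0:\mathcal P^s(A)=\infty\}$, where $\mathcal P^s(A)=\inf\{\sum_i P^s(A_i):A\subset\bigcup_{i\in\mathbb N} A_i\}$, $P^s(A)=\lim_{\varepsilon\downarrow0}\sup\sum_i r_i^s$, the supremum over collections of pairwise disjoint open balls $B(x_i,r_i)$ with $x_i\in A$ and $0<r_i\le\varepsilon$. Subscripts $d$ and $\rho$ refer to $(\overline\Omega^{d},d)$ and $(\overline\Omega^{\rho},d_\rho)$. For real $\beta>-1$ put $$d^{\pm}(\beta)=\dim_d\{x\in\partial_\rho\Omega: i^{\pm}(x)\le\beta\},\qquad D^{\pm}(\beta)=\operatorname{Dim}_d\{x\in\partial_\rho\Omega: i^{\pm}(x)\le\beta\}.$$ **Theorem 4.2.** Let $\Omega\subset\mathbb R^n$ be a John domain and let $\rho$ be a density on $\Omega$ that satisfies Assumption (G). Then, in $[0,\infty]$, $$\dim_\rho(\partial_\rho\Omega)\ \ge\ \sup_{\beta>-1}\frac{d^+(\beta)}{1+\beta},\qquad \operatorname{Dim}_\rho(\partial_\rho\Omega)\ \ge\ \sup_{\beta>-1}\frac{D^+(\beta)}{1+\beta},$$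 $$\dim_\rho\{x\in\partial_\rho\Omega: i^-(x)>-1\}\ \le\ \sup_{\beta>-1}\frac{d^-(\beta)}{1+\beta},\qquad \operatorname{Dim}_\rho\{x\in\partial_\rho\Omega: i^-(x)>-1\}\ \le\ \sup_{\beta>-1}\frac{D^-(\beta)}{1+\beta}.$$ -/

import Mathlib

namespace DensityMetric

open Set Filter Topology MeasureTheory
open scoped ENNReal NNReal

noncomputable section

/-! ### Domains, weights and curves -/

/-- A domain of `ℝⁿ`: a nonempty connected open subset. -/
structure Domain (n : ℕ) where
  carrier : Set (EuclideanSpace ℝ (Fin n))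
  isOpen : IsOpen carrier
  isConnected : IsConnected carrier

variable {n : ℕ}

namespace Domain

/-- The points of the domain. -/
abbrev Pt (Ω : Domain n) : Type := Ω.carrier

/-- `d(x)`: the Euclidean distance from `x ∈ Ω` to the boundary of `Ω`.
(If `Ω = ℝⁿ`, the boundary is empty and this is the junk value `0`; no density in the sense of
`Weight.IsDensity` exists on such a domain.) -/
def bdryDist (Ω : Domain n) (x : Ω.Pt) : ℝ :=
  Metric.infDist (x : EuclideanSpace ℝ (Fin n)) (frontier Ω.carrier)

/-- `γ`, restricted to `[0, L]`, is a rectifiable curve of length `L` in `Ω`, parametrized by arc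
length, that joins `x` to `y`. -/
structure IsCurve (Ω : Domain n) (γ : ℝ → Ω.Pt) (L : ℝ) (x y : Ω.Pt) : Prop where
  length_nonneg : 0 ≤ L
  unitSpeed : HasUnitSpeedOn (fun t => (γ t : EuclideanSpace ℝ (Fin n))) (Icc 0 L)
  source : γ 0 = x
  target : γ L = y

/-- `Ω` is an `α`-John domain: there is a centre `x₀` such that all points `x ∈ Ω` may be joined
to `x₀` by an `α`-cone, a curve `γ` with `d(γ(t)) ≥ α t` for all `0 ≤ t ≤ length(γ)`. -/
def IsJohnWith (Ω : Domain n) (α : ℝ) : Prop :=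
  ∃ x₀ : Ω.Pt, ∀ x : Ω.Pt, ∃ (γ : ℝ → Ω.Pt) (L : ℝ), Ω.IsCurve γ L x x₀ ∧
    ∀ t ∈ Icc (0 : ℝ) L, α * t ≤ Ω.bdryDist (γ t)

/-- `Ω` is a John domain. -/
def IsJohn (Ω : Domain n) : Prop :=
  ∃ α : ℝ, 0 < α ∧ α ≤ 1 ∧ Ω.IsJohnWith α

end Domain

/-- A continuous function `ρ : Ω → (0, ∞)`. -/
structure Weight (Ω : Domain n) where
  toFun : Ω.Pt → ℝ
  continuous : Continuous toFun
  pos : ∀ x, 0 < toFun x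

/-- The weight `1`, whose metric is the internal Euclidean metric. -/
def Domain.unitWeight (Ω : Domain n) : Weight Ω where
  toFun := fun _ => 1
  continuous := continuous_const
  pos := fun _ => one_pos

namespace Weight

variable {Ω : Domain n}

/-- The `ρ`-length `∫_γ ρ |dz|` of a curve parametrized by arc length on `[0, L]`. The endpoints
of the curve may lie on the boundary; they do not matter for the integral. -/
def length (ρ : Weight Ω) (γ : ℝ → Ω.Pt) (L : ℝ) : ℝ≥0∞ :=
  ∫⁻ t in Ioo (0 : ℝ) L, ENNReal.ofReal (ρ.toFun (γ t))

/-- The `ρ`-distance of two points of `Ω`: the infimum of the `ρ`-lengths of the curves in `Ω`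
that join them. -/
def eDist (ρ : Weight Ω) (x y : Ω.Pt) : ℝ≥0∞ :=
  ⨅ (γ : ℝ → Ω.Pt) (L : ℝ) (_ : Ω.IsCurve γ L x y), ρ.length γ L

theorem eDist_le (ρ : Weight Ω) {x y : Ω.Pt} {γ : ℝ → Ω.Pt} {L : ℝ} (h : Ω.IsCurve γ L x y) :
    ρ.eDist x y ≤ ρ.length γ L :=
  iInf_le_of_le γ (iInf_le_of_le L (iInf_le _ h))

theorem eDist_self (ρ : Weight Ω) (x : Ω.Pt) : ρ.eDist x x = 0 := by
  have h : Ω.IsCurve (fun _ => x) 0 x x :=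
    ⟨le_rfl, hasConstantSpeedOnWith_of_subsingleton _ (by simp) _, rfl, rfl⟩
  refine le_antisymm ((ρ.eDist_le h).trans ?_) zero_le
  simp [length]

theorem unitSpeed_iff {γ : ℝ → EuclideanSpace ℝ (Fin n)} {a b : ℝ} :
    HasUnitSpeedOn γ (Icc a b) ↔ ∀ x y, a ≤ x → x ≤ y → y ≤ b →
      eVariationOn γ (Icc x y) = ENNReal.ofReal (y - x) := by
  have key : ∀ x y, a ≤ x → y ≤ b → Icc a b ∩ Icc x y = Icc x y := fun x y hx hy =>
    inter_eq_right.2 (Icc_subset_Icc hx hy)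
  constructor
  · intro h x y hx hxy hy
    have := h ⟨hx, hxy.trans hy⟩ ⟨hx.trans hxy, hy⟩
    simpa [key x y hx hy] using this
  · intro h x hx y hy
    rw [key x y hx.1 hy.2]
    rcases le_total x y with hxy | hxy
    · simpa using h x y hx.1 hxy hy.2
    · rw [eVariationOn.subsingleton γ (subsingleton_Icc_of_ge hxy),
        ENNReal.ofReal_of_nonpos (by simpa using hxy)]

theorem eDist_comm_le (ρ : Weight Ω) (x y : Ω.Pt) : ρ.eDist y x ≤ ρ.eDist x y := by
  refine le_iInf fun γ => le_iInf fun L => le_iInf fun h => ?_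
  have hc : Ω.IsCurve (fun t => γ (L - t)) L y x := by
    refine ⟨h.length_nonneg, ?_, by simpa using h.target, by simpa using h.source⟩
    rw [unitSpeed_iff]
    intro a b ha hab hb
    have h1 := eVariationOn.comp_eq_of_antitoneOn
      (fun t => (γ t : EuclideanSpace ℝ (Fin n))) (t := Icc a b) (fun t => L - t)
      (fun s _ t _ hst => by simpa using sub_le_sub_left hst L)
    have h2 := unitSpeed_iff.1 h.unitSpeed (L - b) (L - a) (by linarith) (by linarith)
      (by linarith)
    rw [image_const_sub_Icc, h2] at h1
    refine h1.trans ?_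
    congr 1
    ring
  refine (ρ.eDist_le hc).trans (le_of_eq ?_)
  have := (Measure.measurePreserving_sub_left (volume : Measure ℝ) L).setLIntegral_comp_preimage_emb
    (MeasurableEquiv.subLeft L).measurableEmbedding
    (fun t => ENNReal.ofReal (ρ.toFun (γ t))) (Ioo 0 L)
  simpa [length] using this

theorem eDist_triangle (ρ : Weight Ω) (x y z : Ω.Pt) :
    ρ.eDist x z ≤ ρ.eDist x y + ρ.eDist y z := by
  classical
  simp only [eDist, ENNReal.iInf_add, ENNReal.add_iInf]
  refine le_iInf fun γ₂ => le_iInf fun L₂ => le_iInf fun h₂ => le_iInf fun γ₁ => le_iInf fun L₁ =>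
    le_iInf fun h₁ => ?_
  have hL₁ := h₁.length_nonneg
  have hL₂ := h₂.length_nonneg
  let γ : ℝ → Ω.Pt := fun t => if t ≤ L₁ then γ₁ t else γ₂ (t - L₁)
  have e₁ : ∀ t, t ≤ L₁ → γ t = γ₁ t := fun t ht => by simp [γ, ht]
  have e₂ : ∀ t, L₁ ≤ t → γ t = γ₂ (t - L₁) := by
    intro t ht
    rcases ht.eq_or_lt with rfl | ht
    · simp [γ, h₁.target, h₂.source]
    · simp [γ, not_le.2 ht]
  have hc : Ω.IsCurve γ (L₁ + L₂) x z := by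
    refine ⟨add_nonneg hL₁ hL₂, HasUnitSpeedOn.Icc_Icc (y := L₁) ?_ ?_, ?_, ?_⟩
    · rw [unitSpeed_iff]
      intro a b ha hab hb
      rw [← unitSpeed_iff.1 h₁.unitSpeed a b ha hab hb]
      exact eVariationOn.eq_of_eqOn fun t ht => by simp only [e₁ t (ht.2.trans hb)]
    · rw [unitSpeed_iff]
      intro a b ha hab hb
      have h3 := eVariationOn.comp_eq_of_monotoneOn
        (fun t => (γ₂ t : EuclideanSpace ℝ (Fin n))) (t := Icc a b) (fun t => t - L₁)
        (fun s _ t _ hst => by simpa using hst)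
      have h4 := unitSpeed_iff.1 h₂.unitSpeed (a - L₁) (b - L₁) (by linarith) (by linarith)
        (by linarith)
      rw [image_sub_const_Icc, h4] at h3
      refine (eVariationOn.eq_of_eqOn fun t ht => ?_).trans (h3.trans ?_)
      · simp only [e₂ t (ha.trans ht.1), Function.comp]
      · congr 1
        ring
    · rw [e₁ 0 hL₁, h₁.source]
    · rw [e₂ _ (by linarith), add_sub_cancel_left, h₂.target]
  refine (ρ.eDist_le hc).trans ?_
  have hsub : Ioo 0 (L₁ + L₂) ⊆ (Ioo 0 L₁ ∪ {L₁}) ∪ Ioo L₁ (L₁ + L₂) := by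
    intro t ht
    rcases lt_trichotomy t L₁ with h | h | h
    · exact Or.inl (Or.inl ⟨ht.1, h⟩)
    · exact Or.inl (Or.inr h)
    · exact Or.inr ⟨h, ht.2⟩
  refine (lintegral_mono_set hsub).trans ((lintegral_union_le _ _ _).trans ?_)
  refine add_le_add ((lintegral_union_le _ _ _).trans ?_) ?_
  · simp only [Measure.restrict_singleton, Real.volume_singleton, zero_smul,
      lintegral_zero_measure, add_zero]
    exact (setLIntegral_congr_fun measurableSet_Ioo fun t ht => by
      simp only [e₁ t ht.2.le]).le
  · rw [setLIntegral_congr_fun (g := fun t => ENNReal.ofReal (ρ.toFun (γ₂ (t - L₁))))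
      measurableSet_Ioo fun t ht => by simp only [e₂ t ht.1.le]]
    have := (measurePreserving_sub_right (volume : Measure ℝ) L₁).setLIntegral_comp_preimage_emb
      (MeasurableEquiv.subRight L₁).measurableEmbedding
      (fun t => ENNReal.ofReal (ρ.toFun (γ₂ t))) (Ioo 0 L₂)
    refine le_of_eq ?_
    simpa [length, add_comm] using this

theorem eventually_eDist_ne_top (ρ : Weight Ω) (x : Ω.Pt) :
    ∀ᶠ y : Ω.Pt in 𝓝 x, ρ.eDist x y ≠ ⊤ := by
  classical
  have h1 : ∀ᶠ z : Ω.Pt in 𝓝 x, ρ.toFun z < ρ.toFun x + 1 :=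
    ρ.continuous.continuousAt.eventually (gt_mem_nhds (lt_add_one _))
  obtain ⟨r, hr, hball⟩ := Metric.eventually_nhds_iff_ball.1 h1
  obtain ⟨q, hq, hsub⟩ := Metric.isOpen_iff.1 Ω.isOpen x x.2
  filter_upwards [Metric.ball_mem_nhds x (lt_min hr hq)] with y hy
  set L : ℝ := dist (y : EuclideanSpace ℝ (Fin n)) x with hL
  have hyL : L < min r q := hy
  have hL0 : 0 ≤ L := dist_nonneg
  rcases eq_or_ne y x with rfl | hne
  · simp [eDist_self]
  have hLpos : 0 < L := dist_pos.2 fun h => hne (Subtype.ext h)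
  set u : EuclideanSpace ℝ (Fin n) := L⁻¹ • ((y : EuclideanSpace ℝ (Fin n)) - x) with hu
  have hun : ‖u‖ = 1 := by
    rw [hu, norm_smul, ← dist_eq_norm, ← hL, norm_inv, Real.norm_of_nonneg hL0,
      inv_mul_cancel₀ hLpos.ne']
  have hd : ∀ t ∈ Icc (0 : ℝ) L,
      dist ((x : EuclideanSpace ℝ (Fin n)) + t • u) x < min r q := by
    intro t ht
    rw [dist_eq_norm, add_sub_cancel_left, norm_smul, hun, mul_one, Real.norm_of_nonneg ht.1]
    exact ht.2.trans_lt hyL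
  have hmem : ∀ t ∈ Icc (0 : ℝ) L, (x : EuclideanSpace ℝ (Fin n)) + t • u ∈ Ω.carrier :=
    fun t ht => hsub (Metric.mem_ball.2 ((hd t ht).trans_le (min_le_right _ _)))
  let γ : ℝ → Ω.Pt := fun t =>
    if h : (x : EuclideanSpace ℝ (Fin n)) + t • u ∈ Ω.carrier then ⟨_, h⟩ else x
  have hγ : ∀ t ∈ Icc (0 : ℝ) L,
      (γ t : EuclideanSpace ℝ (Fin n)) = (x : EuclideanSpace ℝ (Fin n)) + t • u := by
    intro t ht
    simp [γ, hmem t ht]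
  have hc : Ω.IsCurve γ L x y := by
    refine ⟨hL0, ?_, Subtype.ext ?_, Subtype.ext ?_⟩
    · rw [unitSpeed_iff]
      intro a b ha hab hb
      rw [eVariationOn.eq_of_eqOn (f' := fun t : ℝ => (x : EuclideanSpace ℝ (Fin n)) + t • u)
        fun t ht => hγ t ⟨ha.trans ht.1, ht.2.trans hb⟩]
      have hiso : ∀ s t : ℝ, edist ((x : EuclideanSpace ℝ (Fin n)) + s • u)
          ((x : EuclideanSpace ℝ (Fin n)) + t • u) = edist s t := by
        intro s t
        rw [edist_dist, edist_dist, dist_add_left, dist_eq_norm, ← sub_smul, norm_smul, hun,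
          mul_one, ← dist_eq_norm]
      have e1 : eVariationOn (fun t : ℝ => (x : EuclideanSpace ℝ (Fin n)) + t • u) (Icc a b)
          = eVariationOn (fun t : ℝ => t) (Icc a b) := by
        simp only [eVariationOn, hiso]
      rw [e1]
      apply le_antisymm
      · have := (monotone_id.monotoneOn (Icc a b)).eVariationOn_eq (left_mem_Icc.2 hab)
          (right_mem_Icc.2 hab)
        exact le_of_eq (by simpa [Function.id_def] using this)
      · have := eVariationOn.edist_le (fun t : ℝ => t) (right_mem_Icc.2 hab) (left_mem_Icc.2 hab)
        rwa [edist_dist, Real.dist_eq, abs_of_nonneg (sub_nonneg.2 hab)] at this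
    · rw [hγ 0 (left_mem_Icc.2 hL0)]
      simp
    · rw [hγ L (right_mem_Icc.2 hL0), hu, smul_smul, mul_inv_cancel₀ hLpos.ne', one_smul]
      abel
  refine ((ρ.eDist_le hc).trans_lt ?_).ne
  calc ρ.length γ L ≤ ∫⁻ _ in Ioo (0 : ℝ) L, ENNReal.ofReal (ρ.toFun x + 1) := by
        refine setLIntegral_mono' measurableSet_Ioo fun t ht => ENNReal.ofReal_le_ofReal ?_
        have ht' : t ∈ Icc (0 : ℝ) L := Ioo_subset_Icc_self ht
        refine (hball (γ t) ?_).le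
        rw [Metric.mem_ball, Subtype.dist_eq, hγ t ht']
        exact (hd t ht').trans_le (min_le_left _ _)
    _ < ⊤ := by
        rw [setLIntegral_const, Real.volume_Ioo]
        exact ENNReal.mul_lt_top ENNReal.ofReal_lt_top ENNReal.ofReal_lt_top

theorem eDist_ne_top (ρ : Weight Ω) (x y : Ω.Pt) : ρ.eDist x y ≠ ⊤ := by
  have : PreconnectedSpace Ω.Pt := Subtype.preconnectedSpace Ω.isConnected.isPreconnected
  refine PreconnectedSpace.induction₂' (fun x y => ρ.eDist x y ≠ ⊤) (fun x => ?_) ⟨?_⟩ x y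
  · filter_upwards [ρ.eventually_eDist_ne_top x] with y hy
    exact ⟨hy, ((ρ.eDist_comm_le x y).trans_lt hy.lt_top).ne⟩
  · exact fun a b c h₁ h₂ =>
      ((ρ.eDist_triangle a b c).trans_lt (ENNReal.add_lt_top.2 ⟨h₁.lt_top, h₂.lt_top⟩)).ne

/-- The set `Ω`, as the carrier of the metric `d_ρ`. -/
def Space (_ρ : Weight Ω) : Type := Ω.Pt

/-- `Ω` with the metric `d_ρ`. -/
instance (ρ : Weight Ω) : PseudoMetricSpace ρ.Space :=
  @PseudoEMetricSpace.toPseudoMetricSpace ρ.Space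
    { edist := ρ.eDist
      edist_self := ρ.eDist_self
      edist_comm := fun x y => le_antisymm (ρ.eDist_comm_le y x) (ρ.eDist_comm_le x y)
      edist_triangle := ρ.eDist_triangle }
    ρ.eDist_ne_top

/-- The metric completion of `(Ω, d_ρ)`. -/
abbrev Closure (ρ : Weight Ω) : Type := UniformSpace.Completion ρ.Space

/-- The embedding of `Ω` into its completion with respect to `d_ρ`. -/
def incl (ρ : Weight Ω) (x : Ω.Pt) : ρ.Closure :=
  UniformSpace.Completion.coe' (show ρ.Space from x)

/-- The `ρ`-boundary `∂_ρ Ω`: the completion without `Ω`. -/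
def boundary (ρ : Weight Ω) : Set ρ.Closure := (range ρ.incl)ᶜ

end Weight

/-- The completion of `Ω` with respect to the internal metric `d`. -/
abbrev Domain.InternalClosure (Ω : Domain n) : Type := Ω.unitWeight.Closure

/-- The embedding of `Ω` into its completion with respect to the internal metric. -/
abbrev Domain.internalIncl (Ω : Domain n) (x : Ω.Pt) : Ω.InternalClosure := Ω.unitWeight.incl x

namespace Weight

variable {Ω : Domain n}

/-- `ρ` is a density:
* a sequence in `Ω` that converges in the `ρ`-completion converges in the internal completion;
* a sequence in `Ω` that converges in the internal completion has at most one accumulation point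
  in `∂_ρ Ω`;
* `∂_ρ Ω` is nonempty. -/
structure IsDensity (ρ : Weight Ω) : Prop where
  tendsto_internal : ∀ u : ℕ → Ω.Pt,
    (∃ a : ρ.Closure, Tendsto (fun i => ρ.incl (u i)) atTop (𝓝 a)) →
    ∃ b : Ω.InternalClosure, Tendsto (fun i => Ω.internalIncl (u i)) atTop (𝓝 b)
  unique_accumulation : ∀ u : ℕ → Ω.Pt,
    (∃ b : Ω.InternalClosure, Tendsto (fun i => Ω.internalIncl (u i)) atTop (𝓝 b)) →
    ∀ a ∈ ρ.boundary, ∀ a' ∈ ρ.boundary,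
      MapClusterPt a atTop (fun i => ρ.incl (u i)) →
      MapClusterPt a' atTop (fun i => ρ.incl (u i)) → a = a'
  boundary_nonempty : ρ.boundary.Nonempty

/-- The extension `(Ω̄, d_ρ) → (Ω̄, d)` by limits of the identity map of `Ω`. For a density it is
continuous and injective, and it identifies `∂_ρ Ω` with a subset of the internal boundary. -/
def toInternal (ρ : Weight Ω) : ρ.Closure → Ω.InternalClosure :=
  (UniformSpace.Completion.isDenseInducing_coe (α := ρ.Space)).extend
    (fun x : ρ.Space => Ω.internalIncl x)

/-- The `ρ`-boundary as a subset of the internal completion. -/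
def internalBoundary (ρ : Weight Ω) : Set Ω.InternalClosure := ρ.toInternal '' ρ.boundary

/-- The filter of points `y ∈ Ω` tending to `x` in the internal metric. -/
def _root_.DensityMetric.Domain.approach (Ω : Domain n) (x : Ω.InternalClosure) : Filter Ω.Pt :=
  comap Ω.internalIncl (𝓝 x)

/-- The quotient `log ρ(y) / log d(y)`. -/
def exponent (ρ : Weight Ω) (y : Ω.Pt) : EReal :=
  ((Real.log (ρ.toFun y) / Real.log (Ω.bdryDist y) : ℝ) : EReal)

/-- `i⁻(x)`, the lower limit of `log ρ(y) / log d(y)` as `y → x`, `y ∈ Ω`. -/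
def iMinus (ρ : Weight Ω) (x : Ω.InternalClosure) : EReal :=
  liminf ρ.exponent (Ω.approach x)

/-- `i⁺(x)`, the upper limit of `log ρ(y) / log d(y)` as `y → x`, `y ∈ Ω`. -/
def iPlus (ρ : Weight Ω) (x : Ω.InternalClosure) : EReal :=
  limsup ρ.exponent (Ω.approach x)

/-- `γ`, restricted to `(0, L)`, is a rectifiable curve in `Ω` parametrized by arc length, of
length `L > 0`, whose endpoints are the points `x` and `y` of the internal completion. -/
structure _root_.DensityMetric.Domain.JoinsInternally (Ω : Domain n) (γ : ℝ → Ω.Pt) (L : ℝ)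
    (x y : Ω.InternalClosure) : Prop where
  length_pos : 0 < L
  unitSpeed : HasUnitSpeedOn (fun t => (γ t : EuclideanSpace ℝ (Fin n))) (Ioo 0 L)
  source : Tendsto (fun t => Ω.internalIncl (γ t)) (𝓝[>] 0) (𝓝 x)
  target : Tendsto (fun t => Ω.internalIncl (γ t)) (𝓝[<] L) (𝓝 y)

/-- The height `h(γ) = sup_{z ∈ γ} d(z)` of a curve. -/
def _root_.DensityMetric.Domain.height (Ω : Domain n) (γ : ℝ → Ω.Pt) (L : ℝ) : ℝ≥0∞ :=
  ⨆ t ∈ Ioo (0 : ℝ) L, ENNReal.ofReal (Ω.bdryDist (γ t))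

/-- The generalized Gehring–Hayman condition: for each `x ∈ ∂_ρ Ω` and `ε > 0`, every `y` in a
small `ρ`-ball around `x` can be joined to `x` by a curve `γ` in `Ω` with
`h(γ) ≥ d(x, y) ^ (1 + ε)` and `ρ`-length at most `d_ρ(x, y) ^ (1 - ε)`. (For `y = x` there is
nothing to join.) -/
def GehringHayman (ρ : Weight Ω) : Prop :=
  ∀ x ∈ ρ.boundary, ∀ ε : ℝ, 0 < ε → ∃ r : ℝ, 0 < r ∧ ∀ y ∈ Metric.ball x r, y ≠ x →
    ∃ (γ : ℝ → Ω.Pt) (L : ℝ), Ω.JoinsInternally γ L (ρ.toInternal x) (ρ.toInternal y) ∧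
      ENNReal.ofReal (dist (ρ.toInternal x) (ρ.toInternal y) ^ (1 + ε)) ≤ Ω.height γ L ∧
      ρ.length γ L ≤ ENNReal.ofReal (dist x y ^ (1 - ε))

end Weight

/-! ### Packing dimension -/

section Packing

variable {X : Type*} [PseudoMetricSpace X]

/-- `T` is a packing of `A` of mesh at most `ε`: a collection of pairs (centre, radius) with
centres in `A` and radii in `(0, ε]` such that the open balls are pairwise disjoint. -/
structure IsPacking (A : Set X) (ε : ℝ) (T : Set (X × ℝ)) : Prop where
  center_mem : ∀ p ∈ T, p.1 ∈ A
  radius_pos : ∀ p ∈ T, 0 < p.2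
  radius_le : ∀ p ∈ T, p.2 ≤ ε
  disjoint : T.PairwiseDisjoint fun p => Metric.ball p.1 p.2

/-- `P^{s,ε}(A)`: the supremum of `∑ rᵢ ^ s` over the packings of `A` with `rᵢ ≤ ε`. -/
def packingPreAt (s ε : ℝ) (A : Set X) : ℝ≥0∞ :=
  ⨆ (T : Set (X × ℝ)) (_ : IsPacking A ε T), ∑' p : T, ENNReal.ofReal ((p : X × ℝ).2 ^ s)

/-- The packing premeasure `P^s(A)`, the decreasing limit of `P^{s,ε}(A)` as `ε ↓ 0`. -/
def packingPre (s : ℝ) (A : Set X) : ℝ≥0∞ :=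
  ⨅ (ε : ℝ) (_ : 0 < ε), packingPreAt s ε A

/-- The `s`-dimensional packing measure of `A`. -/
def packingMeasure (s : ℝ) (A : Set X) : ℝ≥0∞ :=
  ⨅ (B : ℕ → Set X) (_ : A ⊆ ⋃ i, B i), ∑' i, packingPre s (B i)

/-- The packing dimension of `A`. -/
def dimP (A : Set X) : ℝ≥0∞ :=
  ⨆ (s : ℝ≥0) (_ : packingMeasure (s : ℝ) A = ⊤), (s : ℝ≥0∞)

end Packing

namespace Weight

variable {Ω : Domain n}

/-- `{x ∈ ∂_ρ Ω : i⁺(x) ≤ β}`, as a subset of the internal completion. -/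
def sublevelPlus (ρ : Weight Ω) (β : ℝ) : Set Ω.InternalClosure :=
  {x ∈ ρ.internalBoundary | ρ.iPlus x ≤ (β : EReal)}

/-- `{x ∈ ∂_ρ Ω : i⁻(x) ≤ β}`, as a subset of the internal completion. -/
def sublevelMinus (ρ : Weight Ω) (β : ℝ) : Set Ω.InternalClosure :=
  {x ∈ ρ.internalBoundary | ρ.iMinus x ≤ (β : EReal)}

/-- `d⁺(β)`, a Hausdorff dimension in the internal metric. -/
def dPlus (ρ : Weight Ω) (β : ℝ) : ℝ≥0∞ := dimH (ρ.sublevelPlus β)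

/-- `D⁺(β)`, a packing dimension in the internal metric. -/
def DPlus (ρ : Weight Ω) (β : ℝ) : ℝ≥0∞ := dimP (ρ.sublevelPlus β)

/-- `d⁻(β)`, a Hausdorff dimension in the internal metric. -/
def dMinus (ρ : Weight Ω) (β : ℝ) : ℝ≥0∞ := dimH (ρ.sublevelMinus β)

/-- `D⁻(β)`, a packing dimension in the internal metric. -/
def DMinus (ρ : Weight Ω) (β : ℝ) : ℝ≥0∞ := dimP (ρ.sublevelMinus β)

/-- The part `{x ∈ ∂_ρ Ω : i⁻(x) > -1}` of the `ρ`-boundary, in the `ρ`-completion. -/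
def goodBoundary (ρ : Weight Ω) : Set ρ.Closure :=
  {a ∈ ρ.boundary | (-1 : EReal) < ρ.iMinus (ρ.toInternal a)}

end Weight

end

end DensityMetric

/-! Everything rests on comparing the two metrics near a boundary point: there `ρ` behaves roughly
like a power `d ^ β` of the boundary distance, so an internal scale `r` corresponds to a `ρ`-scale
`r ^ (1 + β)`, and dimensions get divided by `1 + β`.

Lower bounds. If `i⁺(x) < b`, then `ρ ≥ d ^ b` near `x`. A Gehring–Hayman curve from `x` to `y`
reaches a height `h` of about `d(x, y)`, and an arc of length `h / 2` next to its highest point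
already costs about `h ^ (1 + b)` in `ρ`-length. Hence `d(x, y)` is at most about `d_ρ(x, y) ^ (1 /
(1 + b))` (`GehringHayman.dist_toInternal_le`). Countably many pieces make the constants uniform
(`exists_sublevelPlus_pieces`).

Upper bounds. If `i⁻(x) > β`, then `ρ ≤ d ^ β` near `x`. Following a John curve for length `r` leads
from `x` to a point `z` with `d(z) ≥ α r`, at `ρ`-cost of order `r ^ (1 + β)`
(`IsDensity.exists_inner_point`). Boundary points whose Euclidean images are `r`-close may still be
`ρ`-far apart, as they can lie on different sides of the boundary. But their points `z` fill a
Euclidean ball of radius `3 r`, so boundedly many small balls contain them all, and two points `z`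
in the same small ball are joined by a cheap segment (`IsDensity.isHolderTransfer`).

Such a Hölder condition up to finite subdivision (`IsHolderTransfer`) controls both dimensions. For
Hausdorff dimension coverings are transported. Packing dimension is first rewritten through
countable covers by sets with box-counting bounds (`exists_hasBoxBound_cover`, `dimP_le_of_cover`).
In the upper bound the boundary is cut into countably many pieces on which `i⁻` lies between nearby
rationals, and the part with `i⁻ > K` has dimension at most `n / (1 + K)`, which disappears as `K →
∞`. -/

namespace DensityMetric

open Set Filter Topology MeasureTheory
open scoped ENNReal NNReal

/-! ### Coverings and the two dimensions -/

section Dimension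

variable {X Y ι : Type*}

/-- Up to a constant, `r`-separated finite subsets of `A` have at most `r ^ (-s)` elements. -/
def HasBoxBound [PseudoMetricSpace X] (s : ℝ) (A : Set X) : Prop :=
  ∃ C r₀ : ℝ, 0 < r₀ ∧ ∀ r, 0 < r → r < r₀ → ∀ F : Finset X, (F : Set X) ⊆ A →
    (∀ x ∈ F, ∀ y ∈ F, x ≠ y → r ≤ dist x y) → (F.card : ℝ) * r ^ s ≤ C

/-- The packing measure is finite above the dimension, so some cover has finite premeasures. Balls
of radius `r / 2` about `r`-separated points form a packing, which bounds their number; the factor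
`2 ^ s` undoes the halving. -/
theorem exists_hasBoxBound_cover [PseudoMetricSpace X] {A : Set X} {s : ℝ≥0} (h : dimP A < s) :
    ∃ B : ℕ → Set X, A ⊆ ⋃ i, B i ∧ ∀ i, HasBoxBound s (B i) := by
  have h1 : packingMeasure (s : ℝ) A < ⊤ := by
    rw [lt_top_iff_ne_top]
    intro htop
    exact h.not_ge (le_iSup₂ (f := fun (s : ℝ≥0) (_ : packingMeasure (s : ℝ) A = ⊤) => (s : ℝ≥0∞))
      s htop)
  simp only [packingMeasure, iInf_lt_iff] at h1
  obtain ⟨B, hB, hsum⟩ := h1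
  refine ⟨B, hB, fun i => ?_⟩
  have h2 : packingPre (s : ℝ) (B i) < ⊤ := (ENNReal.le_tsum i).trans_lt hsum
  simp only [packingPre, iInf_lt_iff] at h2
  obtain ⟨ε, hε, h3⟩ := h2
  refine ⟨(packingPreAt (s : ℝ) ε (B i)).toReal * 2 ^ (s : ℝ), ε, hε, fun r hr hrε F hF hsep => ?_⟩
  let T : Set (X × ℝ) := (fun x => (x, r / 2)) '' (F : Set X)
  have hT : IsPacking (B i) ε T := by
    refine ⟨?_, ?_, ?_, ?_⟩
    · rintro _ ⟨x, hx, rfl⟩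
      exact hF hx
    · rintro _ ⟨x, hx, rfl⟩
      exact half_pos hr
    · rintro _ ⟨x, hx, rfl⟩
      simp only
      linarith
    · rintro _ ⟨x, hx, rfl⟩ _ ⟨y, hy, rfl⟩ hne
      refine Metric.ball_disjoint_ball ?_
      have := hsep x hx y hy (fun h => hne (by rw [h]))
      simp only
      linarith
  have h4 : ∑' p : T, ENNReal.ofReal ((p : X × ℝ).2 ^ (s : ℝ)) ≤ packingPreAt (s : ℝ) ε (B i) :=
    le_iSup₂ (f := fun (T : Set (X × ℝ)) (_ : IsPacking (B i) ε T) =>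
      ∑' p : T, ENNReal.ofReal ((p : X × ℝ).2 ^ (s : ℝ))) T hT
  have hinj : Function.Injective (fun x : X => (x, r / 2)) := fun x y h => congrArg Prod.fst h
  rw [tsum_image (fun p : X × ℝ => ENNReal.ofReal (p.2 ^ (s : ℝ))) hinj.injOn] at h4
  simp only [Finset.coe_sort_coe, Finset.tsum_subtype F
    (fun _ => ENNReal.ofReal ((r / 2) ^ (s : ℝ))), Finset.sum_const, nsmul_eq_mul] at h4
  have h5 := ENNReal.toReal_mono h3.ne h4
  rw [ENNReal.toReal_mul, ENNReal.toReal_natCast,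
    ENNReal.toReal_ofReal (by positivity), Real.div_rpow hr.le zero_le_two, mul_div_assoc',
    div_le_iff₀ (by positivity)] at h5
  exact h5

/-- The balls of a packing are sorted into dyadic bands by radius. The box bound controls the number
of balls in each band, and the gain `R ^ (t - s)` makes the sum over bands geometric, with a
prefactor `ε ^ (t - s)` that tends to `0`. -/
theorem HasBoxBound.packingPre_eq_zero [PseudoMetricSpace X] {A : Set X} {s t : ℝ}
    (h : HasBoxBound s A) (hs : 0 ≤ s) (hst : s < t) : packingPre t A = 0 := by
  classical
  obtain ⟨C, r₀, hr₀, hC⟩ := h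
  set q : ℝ := (1 / 2) ^ (t - s) with hq
  have hq0 : 0 < q := by positivity
  have hq1 : q < 1 := Real.rpow_lt_one (by norm_num) (by norm_num) (by linarith)
  have key : ∀ ε, 0 < ε → ε < r₀ → packingPreAt t ε A ≤
      ENNReal.ofReal (ε ^ (t - s)) * (ENNReal.ofReal (C * 2 ^ s) * (1 - ENNReal.ofReal q)⁻¹) := by
    intro ε hε hεr
    refine iSup₂_le fun T hT => ?_
    let band : T → ℕ → Prop := fun p k =>
      ε * (1 / 2) ^ (k + 1) < (p : X × ℝ).2 ∧ (p : X × ℝ).2 ≤ ε * (1 / 2) ^ k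
    have hband : ∀ p : T, ∃ k, band p k := by
      intro p
      have h1 := hT.radius_pos p p.2
      have h2 := hT.radius_le p p.2
      obtain ⟨k, hk1, hk2⟩ := exists_nat_pow_near_of_lt_one (div_pos h1 hε)
        ((div_le_one hε).2 h2) (one_half_pos (α := ℝ)) one_half_lt_one
      refine ⟨k, ?_, ?_⟩
      · rwa [lt_div_iff₀' hε] at hk1
      · rwa [div_le_iff₀' hε] at hk2
    have h1 : ∑' p : T, ENNReal.ofReal ((p : X × ℝ).2 ^ t) ≤
        ∑' (p : T) (k : ℕ), if band p k then ENNReal.ofReal ((p : X × ℝ).2 ^ t) else 0 := by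
      refine ENNReal.tsum_le_tsum fun p => ?_
      obtain ⟨k, hk⟩ := hband p
      refine le_trans ?_ (ENNReal.le_tsum k)
      rw [if_pos hk]
    refine h1.trans ?_
    rw [ENNReal.tsum_comm, ← ENNReal.tsum_geometric, ← mul_assoc, ← ENNReal.tsum_mul_left]
    refine ENNReal.tsum_le_tsum fun k => ?_
    rw [ENNReal.tsum_eq_iSup_sum]
    refine iSup_le fun F => ?_
    rw [← Finset.sum_filter]
    set F' := F.filter fun p => band p k
    set R : ℝ := ε * (1 / 2) ^ k with hR
    have hR0 : 0 < R := by positivity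
    have hle : ∑ p ∈ F', ENNReal.ofReal ((p : X × ℝ).2 ^ t) ≤
        F'.card * ENNReal.ofReal (2 ^ s * (R / 2) ^ s * R ^ (t - s)) := by
      rw [← nsmul_eq_mul]
      refine Finset.sum_le_card_nsmul _ _ _ fun p hp => ENNReal.ofReal_le_ofReal ?_
      have hp' := (Finset.mem_filter.1 hp).2
      have hp0 := hT.radius_pos p p.2
      rw [← Real.mul_rpow (by norm_num) (by positivity), mul_div_cancel₀ _ (two_ne_zero),
        ← Real.rpow_add hR0, add_sub_cancel]
      exact Real.rpow_le_rpow hp0.le hp'.2 (hs.trans hst.le)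
    have hinj : Set.InjOn (fun p : T => (p : X × ℝ).1) F' := by
      intro a ha b hb hab
      by_contra hne
      have := hT.disjoint a.2 b.2 (fun h => hne (Subtype.ext h))
      refine Set.disjoint_left.1 this (Metric.mem_ball_self (hT.radius_pos a a.2)) ?_
      simp only at hab
      rw [hab]
      exact Metric.mem_ball_self (hT.radius_pos b b.2)
    have hpow : (1 / 2 : ℝ) ^ k ≤ 1 := pow_le_one₀ (by norm_num) (by norm_num)
    have hcard := hC (R / 2) (by positivity) (by nlinarith)
      (F'.image fun p : T => (p : X × ℝ).1)
      (by
        intro x hx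
        obtain ⟨p, -, rfl⟩ := Finset.mem_image.1 (Finset.mem_coe.1 hx)
        exact hT.center_mem p p.2)
      (by
        intro x hx y hy hxy
        obtain ⟨a, ha, rfl⟩ := Finset.mem_image.1 hx
        obtain ⟨b, hb, rfl⟩ := Finset.mem_image.1 hy
        -- In a general metric space, disjoint balls need not have centres at distance at least the
        -- sum of the radii. Still, neither ball contains the centre of the other, and radii above
        -- `R / 2` give separation `R / 2`.
        have hab : (a : X × ℝ) ≠ b := fun h => hxy (by rw [h])
        have hd := hT.disjoint a.2 b.2 hab
        by_contra! hlt
        have hband := (Finset.mem_filter.1 ha).2.1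
        refine Set.disjoint_left.1 hd (Metric.mem_ball'.2 ?_)
          (Metric.mem_ball_self (hT.radius_pos b b.2))
        refine hlt.trans (lt_of_eq_of_lt ?_ hband)
        rw [hR, pow_succ]
        ring)
    rw [Finset.card_image_of_injOn hinj] at hcard
    refine hle.trans ?_
    rw [← ENNReal.ofReal_natCast, ← ENNReal.ofReal_mul (Nat.cast_nonneg _),
      ← ENNReal.ofReal_pow hq0.le, ← ENNReal.ofReal_mul (by positivity),
      ← ENNReal.ofReal_mul' (by positivity)]
    refine ENNReal.ofReal_le_ofReal ?_
    have e1 : R ^ (t - s) = ε ^ (t - s) * q ^ k := by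
      rw [hR, Real.mul_rpow hε.le (by positivity), hq, ← Real.rpow_natCast, ← Real.rpow_natCast,
        ← Real.rpow_mul (by norm_num), ← Real.rpow_mul (by norm_num), mul_comm (k : ℝ)]
    rw [e1]
    have h3 : 0 ≤ 2 ^ s * (ε ^ (t - s) * q ^ k) := by positivity
    calc _ = (F'.card * (R / 2) ^ s) * (2 ^ s * (ε ^ (t - s) * q ^ k)) := by ring
      _ ≤ C * (2 ^ s * (ε ^ (t - s) * q ^ k)) := mul_le_mul_of_nonneg_right hcard h3
      _ = _ := by ring
  have hlim : Tendsto (fun ε : ℝ => ENNReal.ofReal (ε ^ (t - s)) *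
      (ENNReal.ofReal (C * 2 ^ s) * (1 - ENNReal.ofReal q)⁻¹)) (𝓝[>] 0) (𝓝 0) := by
    have h1 : Tendsto (fun ε : ℝ => ENNReal.ofReal (ε ^ (t - s))) (𝓝[>] 0) (𝓝 0) := by
      have h2 := ((Real.continuous_rpow_const (q := t - s) (by linarith)).tendsto 0).mono_left
        (nhdsWithin_le_nhds (s := Ioi 0))
      rw [Real.zero_rpow (by linarith)] at h2
      simpa using ENNReal.tendsto_ofReal h2
    have hfin : ENNReal.ofReal (C * 2 ^ s) * (1 - ENNReal.ofReal q)⁻¹ ≠ ⊤ := by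
      refine ENNReal.mul_ne_top ENNReal.ofReal_ne_top (ENNReal.inv_ne_top.2 ?_)
      rw [Ne, tsub_eq_zero_iff_le, not_le, ENNReal.ofReal_lt_one]
      exact hq1
    simpa using ENNReal.Tendsto.mul_const h1 (Or.inr hfin)
  refine le_antisymm (ge_of_tendsto hlim ?_) zero_le
  filter_upwards [Ioo_mem_nhdsGT hr₀] with ε hε
  exact (iInf₂_le ε hε.1).trans (key ε hε.1 hε.2)

theorem dimP_le_of_cover [PseudoMetricSpace X] {A : Set X} {s : ℝ≥0} {κ : Type*} [Countable κ]
    (B : κ → Set X) (hA : A ⊆ ⋃ i, B i) (hB : ∀ i, HasBoxBound s (B i)) : dimP A ≤ s := by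
  refine iSup₂_le fun t ht => ?_
  by_contra! hst
  have hst' : (s : ℝ) < t := by exact_mod_cast hst
  have hzero : packingMeasure (t : ℝ) A ≤ 0 := by
    -- With an empty index type there is no surjection from `ℕ`; then `A` is empty.
    rcases isEmpty_or_nonempty κ with hκ | hκ
    · have hE : HasBoxBound s (∅ : Set X) := by
        refine ⟨0, 1, one_pos, fun r _ _ F hF _ => ?_⟩
        have : F = ∅ := by simpa using hF
        simp [this]
      refine (iInf₂_le (fun _ : ℕ => (∅ : Set X)) (by simpa using hA)).trans ?_
      simp [hE.packingPre_eq_zero s.2 hst']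
    · obtain ⟨e, he⟩ := exists_surjective_nat κ
      refine (iInf₂_le (fun i : ℕ => B (e i)) ?_).trans ?_
      · rwa [he.iUnion_comp]
      · simp [(hB _).packingPre_eq_zero s.2 hst']
  rw [ht] at hzero
  simp at hzero

theorem dimP_mono [PseudoMetricSpace X] {A B : Set X} (h : A ⊆ B) : dimP A ≤ dimP B := by
  refine le_of_forall_gt_imp_ge_of_dense fun a ha => ?_
  induction a using ENNReal.recTopCoe with
  | top => exact le_top
  | coe s =>
    obtain ⟨C, hC, hb⟩ := exists_hasBoxBound_cover ha
    exact dimP_le_of_cover C (h.trans hC) hb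

theorem dimP_iUnion_le [PseudoMetricSpace X] {κ : Type*} [Countable κ] (A : κ → Set X)
    {D : ℝ≥0∞} (h : ∀ i, dimP (A i) ≤ D) : dimP (⋃ i, A i) ≤ D := by
  refine le_of_forall_gt_imp_ge_of_dense fun a ha => ?_
  induction a using ENNReal.recTopCoe with
  | top => exact le_top
  | coe s =>
    choose C hC hb using fun i => exists_hasBoxBound_cover ((h i).trans_lt ha)
    refine dimP_le_of_cover (fun p : κ × ℕ => C p.1 p.2) (iUnion_subset fun i => ?_)
      fun p => hb _ _
    refine (hC i).trans (iUnion_subset fun j => ?_)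
    exact subset_iUnion (fun p : κ × ℕ => C p.1 p.2) (i, j)

theorem exists_cover_of_dimH_lt [MetricSpace X] {A : Set X} {s : ℝ≥0} (h : dimH A < s)
    {η : ℝ} (hη : 0 < η) : ∃ (t : ℕ → Set X) (r : ℕ → ℝ), (∀ n, 0 < r n) ∧ A ⊆ ⋃ n, t n ∧
      (∀ n, ∀ a ∈ t n, ∀ b ∈ t n, dist a b ≤ r n) ∧
      ∑' n, ENNReal.ofReal (r n ^ (s : ℝ)) ≤ ENNReal.ofReal η := by
  borelize X
  have hs : (0 : ℝ) < s := by
    have : (0 : ℝ≥0∞) < s := zero_le.trans_lt h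
    exact_mod_cast this
  have h0 := hausdorffMeasure_of_dimH_lt h
  rw [Measure.hausdorffMeasure_apply] at h0
  have h1 := (le_iSup₂ (f := fun (r : ℝ≥0∞) (_ : 0 < r) =>
    ⨅ (t : ℕ → Set X) (_ : A ⊆ ⋃ n, t n) (_ : ∀ n, Metric.ediam (t n) ≤ r),
          ∑' n, ⨆ _ : (t n).Nonempty, Metric.ediam (t n) ^ (s : ℝ)) 1 one_pos).trans_lt
      (h0.trans_lt (ENNReal.ofReal_pos.2 (half_pos hη)))
  simp only [iInf_lt_iff] at h1
  obtain ⟨t, ht, hd, hsum⟩ := h1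
  -- A summable positive slack makes every radius strictly positive, even for pieces of diameter
  -- zero.
  obtain ⟨δ, hδ, hδsum⟩ := ENNReal.exists_pos_sum_of_countable
    (ENNReal.ofReal_pos.2 (half_pos hη)).ne' ℕ
  have hpos : ∀ n, 0 < Metric.diam (t n) ^ (s : ℝ) + δ n := fun n =>
    add_pos_of_nonneg_of_pos (Real.rpow_nonneg Metric.diam_nonneg _) (hδ n)
  refine ⟨t, fun n => (Metric.diam (t n) ^ (s : ℝ) + δ n) ^ (s : ℝ)⁻¹,
    fun n => Real.rpow_pos_of_pos (hpos n) _, ht, fun n a ha b hb => ?_, ?_⟩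
  · refine (Metric.dist_le_diam_of_mem' ((hd n).trans_lt ENNReal.one_lt_top).ne ha hb).trans ?_
    rw [Real.le_rpow_inv_iff_of_pos Metric.diam_nonneg (hpos n).le hs]
    exact le_add_of_nonneg_right (δ n).2
  · have e : ∀ n, ENNReal.ofReal (((Metric.diam (t n) ^ (s : ℝ) + δ n) ^ (s : ℝ)⁻¹) ^ (s : ℝ)) ≤
        (⨆ _ : (t n).Nonempty, Metric.ediam (t n) ^ (s : ℝ)) + δ n := by
      intro n
      rw [Real.rpow_inv_rpow (hpos n).le hs.ne', ENNReal.ofReal_add (by positivity) (NNReal.coe_nonneg _),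
        ENNReal.ofReal_coe_nnreal]
      refine add_le_add_left ?_ _
      rcases (t n).eq_empty_or_nonempty with he | hne
      · simp [he, Real.zero_rpow hs.ne']
      · refine le_iSup_of_le hne ?_
        rw [← ENNReal.ofReal_rpow_of_nonneg Metric.diam_nonneg hs.le, Metric.diam,
          ENNReal.ofReal_toReal ((hd n).trans_lt ENNReal.one_lt_top).ne]
    refine (ENNReal.tsum_le_tsum e).trans ?_
    rw [ENNReal.tsum_add]
    calc _ ≤ ENNReal.ofReal (η / 2) + ENNReal.ofReal (η / 2) := add_le_add hsum.le hδsum.le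
      _ = _ := by rw [← ENNReal.ofReal_add (half_pos hη).le (half_pos hη).le, add_halves]

/-- No smallness of the mesh has to be assumed: each single term `r n ^ s` is at most `η`, so the
diameters tend to `0` with `η`. -/
theorem dimH_le_of_covers [MetricSpace X] {A : Set X} {s : ℝ≥0} (hs : 0 < s) {β : Type*}
    [Countable β] (h : ∀ η : ℝ, 0 < η → ∃ (t : β → Set X) (r : β → ℝ), (∀ n, 0 ≤ r n) ∧
      A ⊆ ⋃ n, t n ∧ (∀ n, ∀ a ∈ t n, ∀ b ∈ t n, dist a b ≤ r n) ∧
      ∑' n, ENNReal.ofReal (r n ^ (s : ℝ)) ≤ ENNReal.ofReal η) : dimH A ≤ s := by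
  borelize X
  have hs' : (0 : ℝ) < s := hs
  choose t r hr hA hd hsum using fun k : ℕ => h (1 / (k + 1)) (by positivity)
  have hlim : Tendsto (fun k : ℕ => ENNReal.ofReal (1 / ((k : ℝ) + 1))) atTop (𝓝 0) := by
    simpa using ENNReal.tendsto_ofReal (tendsto_one_div_add_atTop_nhds_zero_nat (𝕜 := ℝ))
  have hediam : ∀ k i, Metric.ediam (t k i) ≤ ENNReal.ofReal (r k i) := by
    intro k i
    refine Metric.ediam_le fun a ha b hb => ?_
    rw [edist_dist]
    exact ENNReal.ofReal_le_ofReal (hd k i a ha b hb)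
  have hpow : ∀ k i, Metric.ediam (t k i) ^ (s : ℝ) ≤ ENNReal.ofReal (r k i ^ (s : ℝ)) := by
    intro k i
    rw [← ENNReal.ofReal_rpow_of_nonneg (hr k i) hs'.le]
    exact ENNReal.rpow_le_rpow (hediam k i) hs'.le
  have hle := Measure.hausdorffMeasure_le_liminf_tsum (l := atTop) (s : ℝ) A
    (fun k : ℕ => ENNReal.ofReal (1 / ((k : ℝ) + 1)) ^ (s : ℝ)⁻¹)
    (by
      have := (ENNReal.continuous_rpow_const (y := (s : ℝ)⁻¹)).tendsto 0
      rw [ENNReal.zero_rpow_of_pos (inv_pos.2 hs')] at this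
      exact this.comp hlim)
    t (Eventually.of_forall fun k i => by
      rw [ENNReal.le_rpow_inv_iff hs']
      exact (hpow k i).trans ((ENNReal.le_tsum i).trans (hsum k)))
    (Eventually.of_forall hA)
  refine dimH_le_of_hausdorffMeasure_ne_top (ne_top_of_le_ne_top ENNReal.zero_ne_top (hle.trans ?_))
  have hlim' : Tendsto (fun k => ∑' i, Metric.ediam (t k i) ^ (s : ℝ)) atTop (𝓝 0) :=
    tendsto_of_tendsto_of_tendsto_of_le_of_le tendsto_const_nhds hlim (fun _ => zero_le)
      fun k => (ENNReal.tsum_le_tsum (hpow k)).trans (hsum k)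
  exact hlim'.liminf_eq.le

end Dimension

/-! ### Dimension bounds from Hölder conditions up to finite subdivision. -/

section Transfer

variable {X Y ι : Type*}

/-- A Hölder condition of exponent `κ` from the `v`-metric to the `u`-metric on `S`, up to finite
subdivision: subsets of `v`-diameter at most `r` split into boundedly many parts of `u`-diameter
at most `C * r ^ κ`. -/
def IsHolderTransfer [PseudoMetricSpace X] [PseudoMetricSpace Y] (κ : ℝ) (u : ι → X) (v : ι → Y)
    (S : Set ι) : Prop :=
  ∃ (m : ℕ) (C r₀ : ℝ), 0 < C ∧ 0 < r₀ ∧ ∀ r, 0 < r → r < r₀ → ∀ T ⊆ S,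
    (∀ a ∈ T, ∀ b ∈ T, dist (v a) (v b) ≤ r) → ∃ g : Fin m → Set ι, T ⊆ ⋃ j, g j ∧
      ∀ j, ∀ a ∈ g j, ∀ b ∈ g j, dist (u a) (u b) ≤ C * r ^ κ

theorem le_div_of_forall_nnreal {a b : ℝ≥0∞} {κ : ℝ≥0} (hκ : 0 < κ)
    (h : ∀ s : ℝ≥0, b < s → a ≤ (s / κ : ℝ≥0)) : a ≤ b / κ := by
  rw [ENNReal.le_div_iff_mul_le (Or.inl (by exact_mod_cast hκ.ne')) (Or.inl ENNReal.coe_ne_top)]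
  refine le_of_forall_gt_imp_ge_of_dense fun c hc => ?_
  induction c using ENNReal.recTopCoe with
  | top => exact le_top
  | coe s =>
    have := h s hc
    rw [ENNReal.coe_div hκ.ne'] at this
    exact ENNReal.mul_le_of_le_div this

/-- A covering set of size `r` is replaced by `m` pieces of size `C * r ^ κ`, and `(C * r ^ κ) ^ (s
/ κ)` is a constant times `r ^ s`. -/
theorem IsHolderTransfer.dimH_le [MetricSpace X] [MetricSpace Y] {κ : ℝ≥0} (hκ : 0 < κ)
    {u : ι → X} {v : ι → Y} {S : Set ι} (h : IsHolderTransfer κ u v S) :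
    dimH (u '' S) ≤ dimH (v '' S) / κ := by
  obtain ⟨m, C, r₀, hC, hr₀, H⟩ := h
  refine le_div_of_forall_nnreal hκ fun s hs => ?_
  have hs0 : (0 : ℝ) < s := by
    have : (0 : ℝ≥0∞) < s := zero_le.trans_lt hs
    exact_mod_cast this
  have hκ' : (0 : ℝ) < κ := hκ
  refine dimH_le_of_covers (β := Fin m × ℕ) (div_pos hs0 hκ) fun η hη => ?_
  set K : ℝ := m * C ^ ((s : ℝ) / κ) with hK
  have hK0 : 0 ≤ K := by positivity
  -- The second bound forces every `r i ≤ r₀ / 2`, so the transfer condition applies. The `+ 1`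
  -- allows for `K = 0`.
  set η' : ℝ := min (η / (K + 1)) ((r₀ / 2) ^ (s : ℝ)) with hη'
  have hη'0 : 0 < η' := lt_min (by positivity) (by positivity)
  obtain ⟨t, r, hr, hcov, hdist, hsum⟩ := exists_cover_of_dimH_lt hs hη'0
  have hrr : ∀ i, r i < r₀ := by
    intro i
    have h1 := (ENNReal.le_tsum i).trans hsum
    rw [ENNReal.ofReal_le_ofReal_iff hη'0.le] at h1
    have h2 := h1.trans (min_le_right _ _)
    rw [Real.rpow_le_rpow_iff (hr i).le (by positivity) hs0] at h2
    linarith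
  choose g hg1 hg2 using fun i => H (r i) (hr i) (hrr i) (S ∩ v ⁻¹' t i) inter_subset_left
    (fun a ha b hb => hdist i _ ha.2 _ hb.2)
  refine ⟨fun p => u '' g p.2 p.1, fun p => C * r p.2 ^ (κ : ℝ),
    fun p => mul_nonneg hC.le (Real.rpow_nonneg (hr _).le _), ?_, ?_, ?_⟩
  · rintro _ ⟨a, ha, rfl⟩
    obtain ⟨i, hi⟩ := mem_iUnion.1 (hcov (mem_image_of_mem v ha))
    obtain ⟨j, hj⟩ := mem_iUnion.1 (hg1 i ⟨ha, hi⟩)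
    exact mem_iUnion.2 ⟨(j, i), mem_image_of_mem u hj⟩
  · rintro ⟨j, i⟩ _ ⟨a, ha, rfl⟩ _ ⟨b, hb, rfl⟩
    exact hg2 i j a ha b hb
  · have e : ∀ p : Fin m × ℕ, ENNReal.ofReal ((C * r p.2 ^ (κ : ℝ)) ^ ((s / κ : ℝ≥0) : ℝ)) =
        ENNReal.ofReal (C ^ ((s : ℝ) / κ)) * ENNReal.ofReal (r p.2 ^ (s : ℝ)) := by
      intro p
      rw [← ENNReal.ofReal_mul (by positivity), NNReal.coe_div,
        Real.mul_rpow hC.le (Real.rpow_nonneg (hr _).le _), ← Real.rpow_mul (hr _).le,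
        mul_div_cancel₀ _ hκ'.ne']
    simp_rw [e]
    rw [ENNReal.tsum_prod (f := fun (_ : Fin m) (i : ℕ) =>
      ENNReal.ofReal (C ^ ((s : ℝ) / κ)) * ENNReal.ofReal (r i ^ (s : ℝ))), tsum_fintype,
      Finset.sum_const, Finset.card_univ, Fintype.card_fin, nsmul_eq_mul, ENNReal.tsum_mul_left]
    calc _ ≤ (m : ℝ≥0∞) * (ENNReal.ofReal (C ^ ((s : ℝ) / κ)) * ENNReal.ofReal η') := by gcongr
      _ = ENNReal.ofReal (K * η') := by
        rw [← ENNReal.ofReal_natCast, ← ENNReal.ofReal_mul (by positivity),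
          ← ENNReal.ofReal_mul (by positivity), hK, mul_assoc]
      _ ≤ ENNReal.ofReal η := by
        refine ENNReal.ofReal_le_ofReal ?_
        have h1 : η' ≤ η / (K + 1) := min_le_left _ _
        calc K * η' ≤ K * (η / (K + 1)) := by gcongr
          _ ≤ (K + 1) * (η / (K + 1)) := by gcongr; linarith
          _ = η := by field_simp

/-- A separated subset of largest cardinality cannot be enlarged. The alternative `a = b` keeps the
claim true for `r ≤ 0`. -/
theorem exists_maximal_separated [PseudoMetricSpace Y] (v : ι → Y) (G : Finset ι) (r : ℝ) :
    ∃ G' ⊆ G, (∀ a ∈ G', ∀ b ∈ G', a ≠ b → r ≤ dist (v a) (v b)) ∧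
      ∀ a ∈ G, ∃ b ∈ G', a = b ∨ dist (v a) (v b) < r := by
  classical
  let P : Finset ι → Prop := fun F => F ⊆ G ∧ ∀ a ∈ F, ∀ b ∈ F, a ≠ b → r ≤ dist (v a) (v b)
  have hne : (G.powerset.filter P).Nonempty := ⟨∅, by simp [P]⟩
  obtain ⟨F, hF, hmax⟩ := Finset.exists_max_image _ Finset.card hne
  obtain ⟨-, hFG, hsep⟩ := Finset.mem_filter.1 hF
  refine ⟨F, hFG, hsep, fun a ha => ?_⟩
  by_contra! hcon
  have haF : a ∉ F := fun h => (hcon a h).1 rfl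
  have hP : P (insert a F) := by
    refine ⟨Finset.insert_subset ha hFG, fun x hx y hy hxy => ?_⟩
    rcases Finset.mem_insert.1 hx with rfl | hx' <;> rcases Finset.mem_insert.1 hy with rfl | hy'
    · exact absurd rfl hxy
    · exact (hcon y hy').2
    · rw [dist_comm]
      exact (hcon x hx').2
    · exact hsep x hx' y hy' hxy
  have := hmax (insert a F) (Finset.mem_filter.2 ⟨Finset.mem_powerset.2 hP.1, hP⟩)
  rw [Finset.card_insert_of_notMem haF] at this
  omega

/-- A `u`-separated set is thinned to a maximal `v`-separated one, whose size the box bound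
controls. At most `m` points cluster at each remaining point, since each of the `m` parts is too
small in the `u`-metric to hold two. -/
theorem HasBoxBound.of_transfer [PseudoMetricSpace X] [PseudoMetricSpace Y] {κ : ℝ} (hκ : 0 < κ)
    {u : ι → X} {v : ι → Y} {S : Set ι} (h : IsHolderTransfer κ u v S) {B : Set Y} {s : ℝ}
    (hB : HasBoxBound s B) : HasBoxBound (s / κ) (u '' (S ∩ v ⁻¹' B)) := by
  classical
  obtain ⟨m, C, r₀, hC, hr₀, H⟩ := h
  obtain ⟨C', r₁, hr₁, hC'⟩ := hB
  set ρ₀ : ℝ := min (r₀ / 2) r₁ with hρ₀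
  have hρ₀0 : 0 < ρ₀ := lt_min (half_pos hr₀) hr₁
  have h2C : 0 < 2 * C * 2 ^ κ := by positivity
  refine ⟨m * ((2 * C * 2 ^ κ) ^ (s / κ) * C'), 2 * C * 2 ^ κ * ρ₀ ^ κ, by positivity,
    fun R hR hRlt F hF hsep => ?_⟩
  -- Chosen so that `C * (2 * r) ^ κ = R / 2 < R`; clusters have `v`-diameter up to `2 * r`.
  set r : ℝ := (R / (2 * C * 2 ^ κ)) ^ κ⁻¹ with hr
  have hr0 : 0 < r := by positivity
  have hrκ : r ^ κ = R / (2 * C * 2 ^ κ) := Real.rpow_inv_rpow (by positivity) hκ.ne'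
  have hrlt : r < ρ₀ := by
    rw [← Real.rpow_lt_rpow_iff hr0.le hρ₀0.le hκ, hrκ, div_lt_iff₀' h2C]
    exact hRlt
  have hpre : ∀ x : F, ∃ a, a ∈ S ∩ v ⁻¹' B ∧ u a = x := fun x => hF x.2
  choose φ hφ hφu using hpre
  have hφinj : Function.Injective φ := fun x y hxy => Subtype.ext (by rw [← hφu x, ← hφu y, hxy])
  let G : Finset ι := Finset.univ.image φ
  have hGcard : G.card = F.card := by
    rw [Finset.card_image_of_injective _ hφinj, Finset.card_univ, Fintype.card_coe]
  have hGS : ∀ a ∈ G, a ∈ S ∩ v ⁻¹' B := by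
    intro a ha
    obtain ⟨x, -, rfl⟩ := Finset.mem_image.1 ha
    exact hφ x
  have hGsep : ∀ a ∈ G, ∀ b ∈ G, a ≠ b → R ≤ dist (u a) (u b) := by
    intro a ha b hb hab
    obtain ⟨x, -, rfl⟩ := Finset.mem_image.1 ha
    obtain ⟨y, -, rfl⟩ := Finset.mem_image.1 hb
    rw [hφu, hφu]
    exact hsep x x.2 y y.2 fun h => hab (by rw [Subtype.ext h])
  obtain ⟨G', hG'G, hG'sep, hG'max⟩ := exists_maximal_separated v G r
  have hvinj : Set.InjOn v (G' : Set ι) := by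
    intro a ha b hb hab
    by_contra hne
    have := hG'sep a ha b hb hne
    rw [hab, dist_self] at this
    linarith
  have hG'card : (G'.card : ℝ) * r ^ s ≤ C' := by
    rw [← Finset.card_image_of_injOn hvinj]
    refine hC' r hr0 (hrlt.trans_le (min_le_right _ _)) _ ?_ ?_
    · intro y hy
      obtain ⟨a, ha, rfl⟩ := Finset.mem_image.1 (Finset.mem_coe.1 hy)
      exact (hGS a (hG'G ha)).2
    · intro x hx y hy hxy
      obtain ⟨a, ha, rfl⟩ := Finset.mem_image.1 hx
      obtain ⟨b, hb, rfl⟩ := Finset.mem_image.1 hy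
      exact hG'sep a ha b hb fun h => hxy (by rw [h])
  have hcount : G.card ≤ G'.card * m := by
    have hsub : G ⊆ G'.biUnion fun b => G.filter fun a => a = b ∨ dist (v a) (v b) < r := by
      intro a ha
      obtain ⟨b, hb, hab⟩ := hG'max a ha
      exact Finset.mem_biUnion.2 ⟨b, hb, Finset.mem_filter.2 ⟨ha, hab⟩⟩
    refine (Finset.card_le_card hsub).trans (Finset.card_biUnion_le_card_mul _ _ _ fun b hb => ?_)
    set Q := G.filter fun a => a = b ∨ dist (v a) (v b) < r
    have hQ : ∀ a ∈ Q, dist (v a) (v b) ≤ r := by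
      intro a ha
      rcases (Finset.mem_filter.1 ha).2 with rfl | h
      · rw [dist_self]; exact hr0.le
      · exact h.le
    obtain ⟨g, hg1, hg2⟩ := H (2 * r) (by positivity)
      (by linarith [hrlt.trans_le (min_le_left _ _)]) (Q : Set ι)
      (fun a ha => (hGS a (Finset.mem_filter.1 (Finset.mem_coe.1 ha)).1).1)
      (fun a ha b' hb' => by
        have := dist_triangle_right (v a) (v b') (v b)
        linarith [hQ a ha, hQ b' hb'])
    have hch : ∀ a : Q, ∃ j, (a : ι) ∈ g j := fun a => mem_iUnion.1 (hg1 a.2)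
    choose ψ hψ using hch
    have hψinj : Function.Injective ψ := by
      intro a b hab
      by_contra hne
      have h1 := hGsep a (Finset.mem_filter.1 a.2).1 b (Finset.mem_filter.1 b.2).1
        fun h => hne (Subtype.ext h)
      have h2 := hg2 (ψ a) a (hψ a) b (by rw [hab]; exact hψ b)
      rw [Real.mul_rpow zero_le_two hr0.le, hrκ] at h2
      have : C * (2 ^ κ * (R / (2 * C * 2 ^ κ))) = R / 2 := by field_simp
      rw [this] at h2
      linarith
    simpa using Fintype.card_le_of_injective ψ hψinj
  have hRs : R ^ (s / κ) = (2 * C * 2 ^ κ) ^ (s / κ) * r ^ s := by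
    have : R = 2 * C * 2 ^ κ * r ^ κ := by rw [hrκ]; field_simp
    conv_lhs => rw [this]
    rw [Real.mul_rpow h2C.le (by positivity), ← Real.rpow_mul hr0.le, mul_div_cancel₀ _ hκ.ne']
  rw [hRs, ← hGcard]
  have h1 : (G.card : ℝ) ≤ G'.card * m := by exact_mod_cast hcount
  have h2 : 0 < (2 * C * 2 ^ κ) ^ (s / κ) := by positivity
  calc _ ≤ ((G'.card : ℝ) * m) * ((2 * C * 2 ^ κ) ^ (s / κ) * r ^ s) := by gcongr
    _ = m * ((2 * C * 2 ^ κ) ^ (s / κ) * (G'.card * r ^ s)) := by ring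
    _ ≤ _ := by gcongr

theorem IsHolderTransfer.dimP_le [PseudoMetricSpace X] [PseudoMetricSpace Y] {κ : ℝ≥0} (hκ : 0 < κ)
    {u : ι → X} {v : ι → Y} {S : Set ι} (h : IsHolderTransfer κ u v S) :
    dimP (u '' S) ≤ dimP (v '' S) / κ := by
  refine le_div_of_forall_nnreal hκ fun s hs => ?_
  obtain ⟨B, hcov, hB⟩ := exists_hasBoxBound_cover hs
  refine dimP_le_of_cover (fun i => u '' (S ∩ v ⁻¹' B i)) ?_ fun i => ?_
  · rintro _ ⟨a, ha, rfl⟩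
    obtain ⟨i, hi⟩ := mem_iUnion.1 (hcov (mem_image_of_mem v ha))
    exact mem_iUnion.2 ⟨i, mem_image_of_mem u ⟨ha, hi⟩⟩
  · exact (hB i).of_transfer (by exact_mod_cast hκ) h

theorem isHolderTransfer_of_dist_le [PseudoMetricSpace X] [PseudoMetricSpace Y] {κ : ℝ}
    (hκ : 0 ≤ κ) {u : ι → X} {v : ι → Y} {S : Set ι} {C r₀ : ℝ} (hC : 0 < C) (hr₀ : 0 < r₀)
    (h : ∀ a ∈ S, ∀ b ∈ S, dist (v a) (v b) < r₀ → dist (u a) (u b) ≤ C * dist (v a) (v b) ^ κ) :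
    IsHolderTransfer κ u v S := by
  refine ⟨1, C, r₀, hC, hr₀, fun r hr hrr T hT hd => ⟨fun _ => T, ?_, fun _ a ha b hb => ?_⟩⟩
  · exact subset_iUnion (fun _ : Fin 1 => T) 0
  · refine (h a (hT ha) b (hT hb) ((hd a ha b hb).trans_lt hrr)).trans ?_
    gcongr
    exact hd a ha b hb

theorem dimP_image_le_of_lipschitz [PseudoMetricSpace X] [PseudoMetricSpace Y] {f : X → Y}
    (hf : LipschitzWith 1 f) (S : Set X) : dimP (f '' S) ≤ dimP S := by
  have h : IsHolderTransfer ((1 : ℝ≥0) : ℝ) f id S :=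
    isHolderTransfer_of_dist_le zero_le_one one_pos one_pos fun a _ b _ _ => by
      simpa using hf.dist_le_mul a b
  simpa using h.dimP_le one_pos

/-- Volume comparison: disjoint balls of radius `r / 2` centred in a ball of radius `k` fit into the
ball of radius `k + 1`. -/
theorem dimP_le_finrank {E : Type*} [NormedAddCommGroup E] [NormedSpace ℝ E]
    [FiniteDimensional ℝ E] (A : Set E) : dimP A ≤ Module.finrank ℝ E := by
  borelize E
  let μ : Measure E := Measure.addHaar
  refine (dimP_mono (subset_univ A)).trans ?_
  have := dimP_le_of_cover (A := (univ : Set E)) (s := Module.finrank ℝ E)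
    (fun k : ℕ => Metric.ball (0 : E) k) (fun x _ => ?_) fun k => ?_
  · simpa using this
  · obtain ⟨k, hk⟩ := exists_nat_gt ‖x‖
    exact mem_iUnion.2 ⟨k, by simpa using hk⟩
  set V := (μ (Metric.ball 0 1)).toReal with hV
  have hVtop : μ (Metric.ball 0 1) ≠ ⊤ := measure_ball_lt_top.ne
  have hV0 : 0 < V := ENNReal.toReal_pos (Metric.measure_ball_pos _ _ one_pos).ne' hVtop
  have hWtop : μ (Metric.ball 0 (k + 1)) ≠ ⊤ := measure_ball_lt_top.ne
  refine ⟨2 ^ Module.finrank ℝ E * (μ (Metric.ball 0 (k + 1))).toReal / V, 1, one_pos,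
    fun r hr hr1 F hF hsep => ?_⟩
  have hdisj : Set.PairwiseDisjoint (F : Set E) fun x => Metric.ball x (r / 2) := by
    intro x hx y hy hxy
    exact Metric.ball_disjoint_ball (by linarith [hsep x hx y hy hxy])
  have h1 := measure_biUnion_finset (μ := μ) hdisj fun x _ => Metric.isOpen_ball.measurableSet
  have h2 : μ (⋃ x ∈ F, Metric.ball x (r / 2)) ≤ μ (Metric.ball 0 (k + 1)) := by
    refine measure_mono (iUnion₂_subset fun x hx y hy => ?_)
    have hx' := mem_ball_zero_iff.1 (hF hx)
    have hy' := Metric.mem_ball.1 hy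
    rw [mem_ball_zero_iff]
    have := norm_le_norm_add_norm_sub' y x
    rw [dist_eq_norm] at hy'
    linarith
  simp_rw [h1, Measure.addHaar_ball_of_pos μ _ (half_pos hr)] at h2
  rw [Finset.sum_const, nsmul_eq_mul] at h2
  have h3 := ENNReal.toReal_mono hWtop h2
  rw [ENNReal.toReal_mul, ENNReal.toReal_natCast, ENNReal.toReal_mul,
    ENNReal.toReal_ofReal (by positivity), div_pow] at h3
  rw [NNReal.coe_natCast, Real.rpow_natCast, le_div_iff₀ hV0]
  calc _ = 2 ^ Module.finrank ℝ E * (F.card * (r ^ Module.finrank ℝ E /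
        2 ^ Module.finrank ℝ E * V)) := by field_simp
    _ ≤ _ := by gcongr

end Transfer

/-! ### Curves, segments and the two completions -/

theorem HasUnitSpeedOn.edist_le {F : Type*} [PseudoEMetricSpace F] {γ : ℝ → F} {s : Set ℝ}
    (h : HasUnitSpeedOn γ s) {a b : ℝ} (ha : a ∈ s) (hb : b ∈ s) (hab : a ≤ b) :
    edist (γ a) (γ b) ≤ ENNReal.ofReal (b - a) := by
  have h1 := h ha hb
  rw [NNReal.coe_one, one_mul] at h1
  rw [← h1]
  exact eVariationOn.edist_le γ ⟨ha, left_mem_Icc.2 hab⟩ ⟨hb, right_mem_Icc.2 hab⟩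

variable {n : ℕ} {Ω : Domain n}

/-- The set `s` is arbitrary because curves ending on the boundary have unit speed only on an open
interval. -/
theorem Domain.isCurve_sub {γ : ℝ → Ω.Pt} {s : Set ℝ}
    (h : HasUnitSpeedOn (fun t => (γ t : EuclideanSpace ℝ (Fin n))) s) {a b : ℝ} (hab : a ≤ b)
    (hs : Icc a b ⊆ s) : Ω.IsCurve (fun t => γ (a + t)) (b - a) (γ a) (γ b) := by
  refine ⟨sub_nonneg.2 hab, ?_, by simp, by simp⟩
  rw [Weight.unitSpeed_iff]
  intro x y hx hxy hy
  have h3 := eVariationOn.comp_eq_of_monotoneOn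
    (fun t => (γ t : EuclideanSpace ℝ (Fin n))) (t := Icc x y) (fun t => a + t)
    (fun s _ t _ hst => by simpa using hst)
  rw [image_const_add_Icc] at h3
  refine h3.trans ?_
  have hx' : a + x ∈ s := hs ⟨by linarith, by linarith⟩
  have hy' : a + y ∈ s := hs ⟨by linarith, by linarith⟩
  have h4 := h hx' hy'
  rw [inter_eq_right.2 ((Icc_subset_Icc (by linarith) (by linarith)).trans hs), NNReal.coe_one,
    one_mul] at h4
  rw [h4]
  congr 1
  ring

namespace Weight

theorem eDist_le_setLIntegral (ρ : Weight Ω) {γ : ℝ → Ω.Pt} {s : Set ℝ}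
    (h : HasUnitSpeedOn (fun t => (γ t : EuclideanSpace ℝ (Fin n))) s) {a b : ℝ} (hab : a ≤ b)
    (hs : Icc a b ⊆ s) :
    ρ.eDist (γ a) (γ b) ≤ ∫⁻ t in Ioo a b, ENNReal.ofReal (ρ.toFun (γ t)) := by
  refine (ρ.eDist_le (Domain.isCurve_sub h hab hs)).trans (le_of_eq ?_)
  have := (measurePreserving_add_left (volume : Measure ℝ) a).setLIntegral_comp_preimage_emb
    (MeasurableEquiv.addLeft a).measurableEmbedding
    (fun t => ENNReal.ofReal (ρ.toFun (γ t))) (Ioo a b)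
  simpa [length] using this

theorem edist_incl (ρ : Weight Ω) (x y : Ω.Pt) :
    edist (ρ.incl x) (ρ.incl y) = ρ.eDist x y :=
  UniformSpace.Completion.edist_eq (α := ρ.Space) x y

theorem length_unitWeight (γ : ℝ → Ω.Pt) (L : ℝ) :
    Ω.unitWeight.length γ L = ENNReal.ofReal L := by
  simp [length, Domain.unitWeight]

theorem dist_incl_le_of_eDist_le (ρ : Weight Ω) {x y : Ω.Pt} {K : ℝ} (hK : 0 ≤ K)
    (h : ρ.eDist x y ≤ ENNReal.ofReal K) : dist (ρ.incl x) (ρ.incl y) ≤ K := by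
  rw [← ρ.edist_incl, edist_dist] at h
  exact (ENNReal.ofReal_le_ofReal_iff hK).1 h

theorem dist_internalIncl_le {γ : ℝ → Ω.Pt} {s : Set ℝ}
    (h : HasUnitSpeedOn (fun t => (γ t : EuclideanSpace ℝ (Fin n))) s) {a b : ℝ} (hab : a ≤ b)
    (hs : Icc a b ⊆ s) : dist (Ω.internalIncl (γ a)) (Ω.internalIncl (γ b)) ≤ b - a := by
  refine dist_incl_le_of_eDist_le _ (sub_nonneg.2 hab) ?_
  have := eDist_le_setLIntegral Ω.unitWeight h hab hs
  simpa [Domain.unitWeight] using this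

theorem dist_le_dist_internalIncl (x y : Ω.Pt) :
    dist (x : EuclideanSpace ℝ (Fin n)) y ≤ dist (Ω.internalIncl x) (Ω.internalIncl y) := by
  rw [← ENNReal.ofReal_le_ofReal_iff dist_nonneg, ← edist_dist, ← edist_dist,
    Weight.edist_incl]
  refine le_iInf fun γ => le_iInf fun L => le_iInf fun h => ?_
  rw [length_unitWeight, ← h.source, ← h.target]
  simpa using HasUnitSpeedOn.edist_le h.unitSpeed (left_mem_Icc.2 h.length_nonneg)
    (right_mem_Icc.2 h.length_nonneg) h.length_nonneg

theorem eDist_le_of_segment (ρ : Weight Ω) (x y : Ω.Pt) {K : ℝ} (hK : 0 ≤ K)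
    (h : ∀ z ∈ segment ℝ (x : EuclideanSpace ℝ (Fin n)) y,
      ∃ hz : z ∈ Ω.carrier, ρ.toFun ⟨z, hz⟩ ≤ K) :
    ρ.eDist x y ≤ ENNReal.ofReal (K * dist (x : EuclideanSpace ℝ (Fin n)) y) := by
  classical
  set L : ℝ := dist (x : EuclideanSpace ℝ (Fin n)) y with hL
  have hL0 : 0 ≤ L := dist_nonneg
  rcases eq_or_ne x y with rfl | hne
  · simp [eDist_self]
  have hLpos : 0 < L := dist_pos.2 fun h => hne (Subtype.ext h)
  set u : EuclideanSpace ℝ (Fin n) := L⁻¹ • ((y : EuclideanSpace ℝ (Fin n)) - x) with hu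
  have hun : ‖u‖ = 1 := by
    rw [hu, norm_smul, ← dist_eq_norm, dist_comm, ← hL, norm_inv, Real.norm_of_nonneg hL0,
      inv_mul_cancel₀ hLpos.ne']
  have hseg : ∀ t ∈ Icc (0 : ℝ) L,
      (x : EuclideanSpace ℝ (Fin n)) + t • u ∈ segment ℝ (x : EuclideanSpace ℝ (Fin n)) y := by
    intro t ht
    rw [segment_eq_image']
    refine ⟨t / L, ⟨div_nonneg ht.1 hL0, (div_le_one hLpos).2 ht.2⟩, ?_⟩
    simp only [hu, smul_smul, div_eq_mul_inv]
  let γ : ℝ → Ω.Pt := fun t =>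
    if h : (x : EuclideanSpace ℝ (Fin n)) + t • u ∈ Ω.carrier then ⟨_, h⟩ else x
  have hγ : ∀ t ∈ Icc (0 : ℝ) L,
      (γ t : EuclideanSpace ℝ (Fin n)) = (x : EuclideanSpace ℝ (Fin n)) + t • u := by
    intro t ht
    obtain ⟨hz, -⟩ := h _ (hseg t ht)
    simp [γ, hz]
  have hc : Ω.IsCurve γ L x y := by
    refine ⟨hL0, ?_, Subtype.ext ?_, Subtype.ext ?_⟩
    · rw [unitSpeed_iff]
      intro a b ha hab hb
      rw [eVariationOn.eq_of_eqOn (f' := fun t : ℝ => (x : EuclideanSpace ℝ (Fin n)) + t • u)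
        fun t ht => hγ t ⟨ha.trans ht.1, ht.2.trans hb⟩]
      have hiso : ∀ s t : ℝ, edist ((x : EuclideanSpace ℝ (Fin n)) + s • u)
          ((x : EuclideanSpace ℝ (Fin n)) + t • u) = edist s t := by
        intro s t
        rw [edist_dist, edist_dist, dist_add_left, dist_eq_norm, ← sub_smul, norm_smul, hun,
          mul_one, ← dist_eq_norm]
      have e1 : eVariationOn (fun t : ℝ => (x : EuclideanSpace ℝ (Fin n)) + t • u) (Icc a b)
          = eVariationOn (fun t : ℝ => t) (Icc a b) := by
        simp only [eVariationOn, hiso]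
      rw [e1]
      have := (monotone_id.monotoneOn (Icc a b)).eVariationOn_eq (left_mem_Icc.2 hab)
        (right_mem_Icc.2 hab)
      simpa [Function.id_def] using this
    · rw [hγ 0 (left_mem_Icc.2 hL0)]
      simp
    · rw [hγ L (right_mem_Icc.2 hL0), hu, smul_smul, mul_inv_cancel₀ hLpos.ne', one_smul]
      abel
  refine (ρ.eDist_le hc).trans ?_
  calc ρ.length γ L ≤ ∫⁻ _ in Ioo (0 : ℝ) L, ENNReal.ofReal K := by
        refine setLIntegral_mono' measurableSet_Ioo fun t ht => ENNReal.ofReal_le_ofReal ?_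
        have ht' : t ∈ Icc (0 : ℝ) L := Ioo_subset_Icc_self ht
        obtain ⟨hz, hle⟩ := h _ (hseg t ht')
        have : γ t = ⟨_, hz⟩ := Subtype.ext (hγ t ht')
        rwa [this]
    _ = ENNReal.ofReal (K * L) := by
        rw [setLIntegral_const, Real.volume_Ioo, sub_zero, ENNReal.ofReal_mul hK]

theorem continuous_incl (ρ : Weight Ω) : Continuous ρ.incl := by
  rw [continuous_iff_continuousAt]
  intro x
  have h1 : ∀ᶠ z : Ω.Pt in 𝓝 x, ρ.toFun z < ρ.toFun x + 1 :=
    ρ.continuous.continuousAt.eventually (gt_mem_nhds (lt_add_one _))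
  obtain ⟨r, hr, hball⟩ := Metric.eventually_nhds_iff_ball.1 h1
  obtain ⟨q, hq, hsub⟩ := Metric.isOpen_iff.1 Ω.isOpen x x.2
  have hρ := ρ.pos x
  have hbound : ∀ᶠ y in 𝓝 x, dist (ρ.incl y) (ρ.incl x) ≤ (ρ.toFun x + 1) * dist y x := by
    filter_upwards [Metric.ball_mem_nhds x (lt_min hr hq)] with y hy
    refine ρ.dist_incl_le_of_eDist_le (by positivity) ?_
    refine ρ.eDist_le_of_segment y x (by linarith) fun z hz => ?_
    have hz' : z ∈ Metric.ball (x : EuclideanSpace ℝ (Fin n)) (min r q) :=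
      (convex_ball _ _).segment_subset hy (Metric.mem_ball_self (lt_min hr hq)) hz
    refine ⟨hsub (Metric.ball_subset_ball (min_le_right _ _) hz'), (hball _ ?_).le⟩
    exact Metric.ball_subset_ball (min_le_left _ _) hz'
  rw [ContinuousAt, tendsto_iff_dist_tendsto_zero]
  refine squeeze_zero' (Eventually.of_forall fun _ => dist_nonneg) hbound ?_
  have : Tendsto (fun y : Ω.Pt => dist y x) (𝓝 x) (𝓝 0) :=
    tendsto_iff_dist_tendsto_zero.1 tendsto_id
  simpa using this.const_mul (ρ.toFun x + 1)

theorem denseRange_incl (ρ : Weight Ω) : DenseRange ρ.incl :=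
  UniformSpace.Completion.denseRange_coe (α := ρ.Space)

theorem exists_seq_tendsto (ρ : Weight Ω) (a : ρ.Closure) :
    ∃ u : ℕ → Ω.Pt, Tendsto (fun i => ρ.incl (u i)) atTop (𝓝 a) := by
  obtain ⟨v, hv, hlim⟩ := mem_closure_iff_seq_limit.1 (ρ.denseRange_incl a)
  choose u hu using hv
  exact ⟨u, by simpa only [hu] using hlim⟩

end Weight

/-- The `1`-Lipschitz extension of the inclusion `Ω → ℝⁿ` to the internal completion. -/
noncomputable def Domain.toEuclidean (Ω : Domain n) :
    Ω.InternalClosure → EuclideanSpace ℝ (Fin n) :=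
  UniformSpace.Completion.extension (α := Ω.unitWeight.Space) (fun x : Ω.Pt => x.1)

theorem Domain.lipschitzWith_coe (Ω : Domain n) :
    LipschitzWith (α := Ω.unitWeight.Space) 1 (fun x : Ω.Pt => x.1) :=
  LipschitzWith.of_dist_le_mul fun x y => by
    rw [NNReal.coe_one, one_mul]
    exact (Weight.dist_le_dist_internalIncl (Ω := Ω) x y).trans
      (UniformSpace.Completion.dist_eq (α := Ω.unitWeight.Space) x y).le

theorem Domain.lipschitzWith_toEuclidean (Ω : Domain n) : LipschitzWith 1 Ω.toEuclidean :=
  Ω.lipschitzWith_coe.completion_extension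

theorem Domain.toEuclidean_incl (x : Ω.Pt) : Ω.toEuclidean (Ω.internalIncl x) = x :=
  UniformSpace.Completion.extension_coe Ω.lipschitzWith_coe.uniformContinuous _

/-- The ball is connected and misses the frontier, so it cannot meet both `Ω` and the complement of
its closure. -/
theorem Domain.ball_bdryDist_subset (w : Ω.Pt) :
    Metric.ball (w : EuclideanSpace ℝ (Fin n)) (Ω.bdryDist w) ⊆ Ω.carrier := by
  rcases le_or_gt (Ω.bdryDist w) 0 with h | h
  · simp [Metric.ball_eq_empty.2 h]
  have hpre : IsPreconnected (Metric.ball (w : EuclideanSpace ℝ (Fin n)) (Ω.bdryDist w)) :=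
    (convex_ball _ _).isPreconnected
  by_contra hcon
  have := isPreconnected_iff_subset_of_disjoint.1 hpre Ω.carrier (closure Ω.carrier)ᶜ Ω.isOpen
    isClosed_closure.isOpen_compl ?_ ?_
  · rcases this with h1 | h1
    · exact hcon h1
    · exact h1 (Metric.mem_ball_self h) (subset_closure w.2)
  · intro z hz
    by_contra hz'
    simp only [mem_union, mem_compl_iff, not_or, not_not] at hz'
    have : z ∈ frontier Ω.carrier := ⟨hz'.2, by rw [Ω.isOpen.interior_eq]; exact hz'.1⟩
    have h1 := Metric.infDist_le_dist_of_mem (x := (w : EuclideanSpace ℝ (Fin n))) this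
    rw [Metric.mem_ball'] at hz
    exact absurd hz (not_lt.2 h1)
  · ext z
    simp only [mem_inter_iff, mem_compl_iff, mem_empty_iff_false, iff_false, not_and, not_not]
    exact fun _ hz => subset_closure hz

theorem Domain.bdryDist_le_add (w z : Ω.Pt) :
    Ω.bdryDist w ≤ Ω.bdryDist z + dist (w : EuclideanSpace ℝ (Fin n)) z :=
  Metric.infDist_le_infDist_add_dist

/-- Otherwise a sequence in `Ω` tending to `x` would eventually stay in a compact ball inside `Ω`. A
subsequence would converge in `Ω`, hence also internally, and `x` would be a point of `Ω`. -/
theorem Domain.bdryDist_le_dist {x : Ω.InternalClosure} (hx : x ∉ range Ω.internalIncl)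
    (w : Ω.Pt) : Ω.bdryDist w ≤ dist (Ω.internalIncl w) x := by
  by_contra! hlt
  obtain ⟨δ, hδ1, hδ2⟩ := exists_between hlt
  obtain ⟨u, hu⟩ := Ω.unitWeight.exists_seq_tendsto x
  have hev : ∀ᶠ i in atTop, (u i : EuclideanSpace ℝ (Fin n)) ∈ Metric.closedBall
      (w : EuclideanSpace ℝ (Fin n)) δ := by
    have h1 : Tendsto (fun i => dist (Ω.internalIncl w) (Ω.internalIncl (u i))) atTop
        (𝓝 (dist (Ω.internalIncl w) x)) := tendsto_const_nhds.dist hu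
    filter_upwards [h1.eventually (gt_mem_nhds hδ1)] with i hi
    rw [Metric.mem_closedBall']
    exact (Weight.dist_le_dist_internalIncl _ _).trans hi.le
  have hcpt := isCompact_closedBall (w : EuclideanSpace ℝ (Fin n)) δ
  obtain ⟨b, hb, φ, hφ, hlim⟩ := hcpt.tendsto_subseq' hev.frequently
  have hbΩ : b ∈ Ω.carrier :=
    Domain.ball_bdryDist_subset w (Metric.closedBall_subset_ball hδ2 hb)
  have h2 : Tendsto (u ∘ φ) atTop (𝓝 (⟨b, hbΩ⟩ : Ω.Pt)) := tendsto_subtype_rng.2 hlim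
  have h3 := (Ω.unitWeight.continuous_incl.tendsto ⟨b, hbΩ⟩).comp h2
  exact hx ⟨⟨b, hbΩ⟩, tendsto_nhds_unique h3 (hu.comp hφ.tendsto_atTop)⟩

/-! ### The map between the completions -/

/-- The density axioms speak of one sequence at a time; interleaving lets them compare the limits of
two. -/
theorem exists_interleaved {α : Type*} (u v : ℕ → α) : ∃ w : ℕ → α, (∀ k, w (2 * k) = u k) ∧
    (∀ k, w (2 * k + 1) = v k) ∧ ∀ l : Filter α, Tendsto u atTop l → Tendsto v atTop l →
      Tendsto w atTop l := by
  classical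
  refine ⟨fun k => if Even k then u (k / 2) else v (k / 2), fun k => by simp, fun k => ?_,
    fun l hu hv => ?_⟩
  · have : (2 * k + 1) / 2 = k := by omega
    simp [this]
  · have h2 : Tendsto (fun k : ℕ => k / 2) atTop atTop :=
      Nat.tendsto_div_const_atTop two_ne_zero
    exact Tendsto.if' (hu.comp h2) (hv.comp h2)

theorem tendsto_two_mul_atTop : Tendsto (fun k : ℕ => 2 * k) atTop atTop :=
  tendsto_atTop_mono (fun k => by simp only [id]; omega) tendsto_id

theorem tendsto_two_mul_add_one_atTop : Tendsto (fun k : ℕ => 2 * k + 1) atTop atTop :=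
  tendsto_atTop_mono (fun k => by simp only [id]; omega) tendsto_id

namespace Weight

variable {ρ : Weight Ω}

theorem IsDensity.exists_tendsto (hρ : ρ.IsDensity) (a : ρ.Closure) :
    ∃ c, Tendsto Ω.internalIncl (comap ρ.incl (𝓝 a)) (𝓝 c) := by
  obtain ⟨u, hu⟩ := ρ.exists_seq_tendsto a
  obtain ⟨c, hc⟩ := hρ.tendsto_internal u ⟨a, hu⟩
  refine ⟨c, tendsto_of_seq_tendsto fun v hv => ?_⟩
  obtain ⟨w, hw1, hw2, hw⟩ := exists_interleaved u v
  have hlim := hw (comap ρ.incl (𝓝 a)) (tendsto_comap_iff.2 hu) hv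
  obtain ⟨c', hc'⟩ := hρ.tendsto_internal w ⟨a, tendsto_comap_iff.1 hlim⟩
  have h1 := hc'.comp tendsto_two_mul_atTop
  have h2 := hc'.comp tendsto_two_mul_add_one_atTop
  simp only [Function.comp_def, hw1, hw2] at h1 h2
  rw [tendsto_nhds_unique hc h1]
  exact h2

theorem IsDensity.tendsto_toInternal (hρ : ρ.IsDensity) (a : ρ.Closure) :
    Tendsto Ω.internalIncl (comap ρ.incl (𝓝 a)) (𝓝 (ρ.toInternal a)) := by
  obtain ⟨c, hc⟩ := hρ.exists_tendsto a
  have : ρ.toInternal a = c :=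
    (UniformSpace.Completion.isDenseInducing_coe (α := ρ.Space)).extend_eq_of_tendsto hc
  rwa [this]

theorem IsDensity.continuous_toInternal (hρ : ρ.IsDensity) : Continuous ρ.toInternal :=
  (UniformSpace.Completion.isDenseInducing_coe (α := ρ.Space)).continuous_extend
    hρ.exists_tendsto

theorem IsDensity.toInternal_incl (hρ : ρ.IsDensity) (x : Ω.Pt) :
    ρ.toInternal (ρ.incl x) = Ω.internalIncl x := by
  have h1 : Tendsto (fun _ : ℕ => x) atTop (comap ρ.incl (𝓝 (ρ.incl x))) :=
    tendsto_comap_iff.2 tendsto_const_nhds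
  exact tendsto_nhds_unique ((hρ.tendsto_toInternal _).comp h1) tendsto_const_nhds

/-- Internal convergence to a point of `Ω` implies Euclidean convergence, and this implies
`ρ`-convergence to the same point because `ρ` is locally bounded. -/
theorem IsDensity.toInternal_notMem_range (hρ : ρ.IsDensity) {a : ρ.Closure}
    (ha : a ∈ ρ.boundary) : ρ.toInternal a ∉ range Ω.internalIncl := by
  rintro ⟨b, hb⟩
  obtain ⟨u, hu⟩ := ρ.exists_seq_tendsto a
  have h1 : Tendsto (fun i => Ω.internalIncl (u i)) atTop (𝓝 (Ω.internalIncl b)) := by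
    rw [hb]
    exact (hρ.tendsto_toInternal a).comp (tendsto_comap_iff.2 hu)
  have h2 : Tendsto u atTop (𝓝 b) := by
    rw [tendsto_iff_dist_tendsto_zero] at h1 ⊢
    exact squeeze_zero (fun _ => dist_nonneg) (fun i => dist_le_dist_internalIncl _ _) h1
  exact ha ⟨b, tendsto_nhds_unique ((ρ.continuous_incl.tendsto b).comp h2) hu⟩

theorem IsDensity.injOn_toInternal (hρ : ρ.IsDensity) : InjOn ρ.toInternal ρ.boundary := by
  intro a ha b hb hab
  obtain ⟨u, hu⟩ := ρ.exists_seq_tendsto a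
  obtain ⟨v, hv⟩ := ρ.exists_seq_tendsto b
  obtain ⟨w, hw1, hw2, hw⟩ := exists_interleaved u v
  have hlim := hw (comap Ω.internalIncl (𝓝 (ρ.toInternal a)))
    (tendsto_comap_iff.2 ((hρ.tendsto_toInternal a).comp (tendsto_comap_iff.2 hu)))
    (tendsto_comap_iff.2 (by
      rw [hab]
      exact (hρ.tendsto_toInternal b).comp (tendsto_comap_iff.2 hv)))
  refine hρ.unique_accumulation w ⟨_, tendsto_comap_iff.1 hlim⟩ a ha b hb ?_ ?_
  · refine MapClusterPt.of_comp tendsto_two_mul_atTop ?_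
    simp only [Function.comp_def, hw1]
    exact hu.mapClusterPt
  · refine MapClusterPt.of_comp tendsto_two_mul_add_one_atTop ?_
    simp only [Function.comp_def, hw2]
    exact hv.mapClusterPt

theorem IsDensity.eventually_comap (hρ : ρ.IsDensity) {a : ρ.Closure} {p : Ω.Pt → Prop}
    (h : ∀ᶠ w in Ω.approach (ρ.toInternal a), p w) :
    ∃ r, 0 < r ∧ ∀ w, dist (ρ.incl w) a < r → p w := by
  have h1 : comap ρ.incl (𝓝 a) ≤ Ω.approach (ρ.toInternal a) :=
    map_le_iff_le_comap.1 (hρ.tendsto_toInternal a)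
  obtain ⟨r, hr, h2⟩ := (Metric.nhds_basis_ball.comap ρ.incl).eventually_iff.1 (h1 h)
  exact ⟨r, hr, fun w hw => h2 hw⟩

/-! ### Metric comparison from above: curves of the Gehring–Hayman condition -/

theorem _root_.DensityMetric.Domain.JoinsInternally.dist_source_le {γ : ℝ → Ω.Pt} {L : ℝ}
    {x y : Ω.InternalClosure} (h : Ω.JoinsInternally γ L x y) {t : ℝ} (ht : t ∈ Ioo 0 L) :
    dist (Ω.internalIncl (γ t)) x ≤ t := by
  have h1 : Tendsto (fun s => dist (Ω.internalIncl (γ t)) (Ω.internalIncl (γ s))) (𝓝[>] 0)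
      (𝓝 (dist (Ω.internalIncl (γ t)) x)) := tendsto_const_nhds.dist h.source
  refine le_of_tendsto h1 ?_
  filter_upwards [Ioo_mem_nhdsGT ht.1] with s hs
  rw [dist_comm]
  have := dist_internalIncl_le h.unitSpeed hs.2.le (Icc_subset_Ioo hs.1 ht.2)
  linarith [hs.1]

/-- The curve is only known to start at `a` in the internal metric. Finite `ρ`-length makes its
beginning `ρ`-Cauchy; the `ρ`-limit has the same internal image as `a`, so injectivity on the
boundary identifies it with `a`. -/
theorem IsDensity.dist_incl_le_length (hρ : ρ.IsDensity) {a : ρ.Closure} (ha : a ∈ ρ.boundary)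
    {γ : ℝ → Ω.Pt} {L : ℝ} {y : Ω.InternalClosure} (h : Ω.JoinsInternally γ L (ρ.toInternal a) y)
    {K : ℝ} (hK : 0 ≤ K) (hlen : ρ.length γ L ≤ ENNReal.ofReal K) {t : ℝ} (ht : t ∈ Ioo 0 L) :
    dist (ρ.incl (γ t)) a ≤ K := by
  have hL := h.length_pos
  have hdist : ∀ s t, 0 < s → s ≤ t → t < L → edist (ρ.incl (γ s)) (ρ.incl (γ t)) ≤
      ∫⁻ τ in Ioo 0 t, ENNReal.ofReal (ρ.toFun (γ τ)) := by
    intro s t hs hst ht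
    rw [ρ.edist_incl]
    exact (ρ.eDist_le_setLIntegral h.unitSpeed hst (Icc_subset_Ioo hs ht)).trans
      (lintegral_mono_set (Ioo_subset_Ioo_left hs.le))
  have hsmall : Tendsto (fun t => ∫⁻ τ in Ioo 0 t, ENNReal.ofReal (ρ.toFun (γ τ))) (𝓝[>] 0)
      (𝓝 0) := by
    have h1 : Tendsto (fun t : ℝ => ∫⁻ τ in Ioo 0 t, ENNReal.ofReal (ρ.toFun (γ τ))
        ∂(volume.restrict (Ioo 0 L))) (𝓝[>] 0) (𝓝 0) := by
      refine tendsto_setLIntegral_zero (hlen.trans_lt ENNReal.ofReal_lt_top).ne ?_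
      have h2 : Tendsto (fun t : ℝ => ENNReal.ofReal t) (𝓝[>] 0) (𝓝 0) := by
        have := (ENNReal.continuous_ofReal.tendsto 0).mono_left (nhdsWithin_le_nhds (s := Ioi 0))
        simpa using this
      refine tendsto_of_tendsto_of_tendsto_of_le_of_le tendsto_const_nhds h2
        (fun _ => zero_le) fun t => ?_
      refine (Measure.restrict_apply_le _ _).trans ?_
      simp
    refine h1.congr' ?_
    filter_upwards [Ioo_mem_nhdsGT hL] with t ht
    rw [Measure.restrict_restrict measurableSet_Ioo,
      inter_eq_left.2 (Ioo_subset_Ioo_right ht.2.le)]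
  have hcauchy : Cauchy (map (fun s => ρ.incl (γ s)) (𝓝[>] 0)) := by
    rw [Metric.cauchy_iff]
    refine ⟨inferInstance, fun ε hε => ?_⟩
    obtain ⟨t, ht1, ht2⟩ := ((hsmall.eventually (gt_mem_nhds (ENNReal.ofReal_pos.2 hε))).and
      (Ioo_mem_nhdsGT hL)).exists
    refine ⟨_, image_mem_map (Ioo_mem_nhdsGT ht2.1), ?_⟩
    have key : ∀ s s', 0 < s → s ≤ s' → s' < t → dist (ρ.incl (γ s)) (ρ.incl (γ s')) < ε := by
      intro s s' hs hss hst
      rw [← ENNReal.ofReal_lt_ofReal_iff hε, ← edist_dist]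
      exact ((hdist s s' hs hss (hst.trans ht2.2)).trans
        (lintegral_mono_set (Ioo_subset_Ioo_right hst.le))).trans_lt ht1
    rintro _ ⟨s, hs, rfl⟩ _ ⟨s', hs', rfl⟩
    rcases le_total s s' with hss | hss
    · exact key s s' hs.1 hss hs'.2
    · rw [dist_comm]
      exact key s' s hs'.1 hss hs.2
  obtain ⟨a', ha'⟩ := cauchy_map_iff_exists_tendsto.1 hcauchy
  have hT : ρ.toInternal a' = ρ.toInternal a := by
    have h1 := (hρ.continuous_toInternal.tendsto a').comp ha'
    simp only [Function.comp_def, hρ.toInternal_incl] at h1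
    exact tendsto_nhds_unique h1 h.source
  have hab : a' ∈ ρ.boundary := by
    rintro ⟨b, rfl⟩
    rw [hρ.toInternal_incl] at hT
    exact hρ.toInternal_notMem_range ha ⟨b, hT⟩
  rw [hρ.injOn_toInternal hab ha hT] at ha'
  refine le_of_tendsto (tendsto_const_nhds.dist ha') ?_
  filter_upwards [Ioo_mem_nhdsGT ht.1] with s hs
  rw [dist_comm]
  refine ρ.dist_incl_le_of_eDist_le hK ?_
  rw [← ρ.edist_incl]
  exact (hdist s t hs.1 hs.2.le ht.2).trans
    ((lintegral_mono_set (Ioo_subset_Ioo_right ht.2.le)).trans hlen)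

theorem two_rpow_mul_le {b h d : ℝ} (hh : 0 < h) (h1 : h / 2 ≤ d) (h2 : d ≤ 2 * h) :
    2 ^ (-|b|) * h ^ b ≤ d ^ b := by
  have hd : 0 < d := (half_pos hh).trans_le h1
  rcases le_total 0 b with hb | hb
  · rw [abs_of_nonneg hb]
    refine le_of_eq_of_le ?_ (Real.rpow_le_rpow (half_pos hh).le h1 hb)
    rw [Real.div_rpow hh.le zero_le_two, Real.rpow_neg zero_le_two]
    ring
  · rw [abs_of_nonpos hb, neg_neg, ← Real.mul_rpow zero_le_two hh.le]
    exact Real.rpow_le_rpow_of_nonpos hd h2 hb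

theorem rpow_bdryDist_lt_of_exponent_lt {w : Ω.Pt} {b : ℝ} (h0 : 0 < Ω.bdryDist w)
    (h1 : Ω.bdryDist w < 1) (h : ρ.exponent w < b) : Ω.bdryDist w ^ b < ρ.toFun w := by
  have h2 : Real.log (ρ.toFun w) / Real.log (Ω.bdryDist w) < b := EReal.coe_lt_coe_iff.1 h
  rw [div_lt_iff_of_neg (Real.log_neg h0 h1)] at h2
  rwa [← Real.log_lt_log_iff (Real.rpow_pos_of_pos h0 _) (ρ.pos w), Real.log_rpow h0]

theorem lt_rpow_bdryDist_of_lt_exponent {w : Ω.Pt} {b : ℝ} (h0 : 0 < Ω.bdryDist w)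
    (h1 : Ω.bdryDist w < 1) (h : b < ρ.exponent w) : ρ.toFun w < Ω.bdryDist w ^ b := by
  have h2 : b < Real.log (ρ.toFun w) / Real.log (Ω.bdryDist w) := EReal.coe_lt_coe_iff.1 h
  rw [lt_div_iff_of_neg (Real.log_neg h0 h1)] at h2
  rwa [← Real.log_lt_log_iff (ρ.pos w) (Real.rpow_pos_of_pos h0 _), Real.log_rpow h0]

/-- The `ρ`-cost of an arc near the top of the curve, about `h ^ (1 + b)`, is at most `dist a y ^ (1
- ε)`, while `h` is at least about `D ^ (1 + ε)`. -/
theorem GehringHayman.dist_toInternal_le (hGH : ρ.GehringHayman) (hρ : ρ.IsDensity)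
    {a : ρ.Closure} (ha : a ∈ ρ.boundary) {b : ℝ} (hb : -1 < b)
    (hi : ρ.iPlus (ρ.toInternal a) < b) {ε : ℝ} (hε : 0 < ε) (hε1 : ε < 1) :
    ∃ C r, 0 < C ∧ 0 < r ∧ ∀ y, dist a y < r → dist (ρ.toInternal a) (ρ.toInternal y) ≤
      C * dist a y ^ ((1 - ε) / ((1 + ε) * (1 + b))) := by
  have hb' : 0 < 1 + b := by linarith
  have hnear : ∀ᶠ w in Ω.approach (ρ.toInternal a),
      dist (Ω.internalIncl w) (ρ.toInternal a) < 1 :=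
    preimage_mem_comap (Metric.ball_mem_nhds (ρ.toInternal a) one_pos)
  obtain ⟨r₁, hr₁, hnbhd⟩ := hρ.eventually_comap ((eventually_lt_of_limsup_lt hi).and hnear)
  obtain ⟨r₂, hr₂, hcurve⟩ := hGH a ha ε hε
  set p : ℝ := (1 + ε) * (1 + b) with hp
  have hp0 : 0 < p := by positivity
  set C₀ : ℝ := 2 ^ (1 + b) * (2 ^ |b| * 2) with hC₀
  have hC₀0 : 0 < C₀ := by positivity
  -- The second radius gives `dist a y ^ (1 - ε) < r₁`, which keeps the whole curve where the bound
  -- on the exponent holds.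
  refine ⟨C₀ ^ p⁻¹, min r₂ (r₁ ^ (1 - ε)⁻¹), by positivity, lt_min hr₂ (by positivity),
    fun y hy => ?_⟩
  rcases eq_or_ne (ρ.toInternal a) (ρ.toInternal y) with hTy | hTy
  · rw [hTy, dist_self]
    positivity
  set D := dist (ρ.toInternal a) (ρ.toInternal y) with hD
  have hD0 : 0 < D := dist_pos.2 hTy
  have hδ1 : dist a y ^ (1 - ε) < r₁ := by
    have := Real.rpow_lt_rpow dist_nonneg (hy.trans_le (min_le_right _ _)) (sub_pos.2 hε1)
    rwa [Real.rpow_inv_rpow hr₁.le (sub_pos.2 hε1).ne'] at this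
  obtain ⟨γ, L, hγ, hheight, hlen⟩ := hcurve y
    (by rw [Metric.mem_ball']; exact hy.trans_le (min_le_left _ _)) (fun h => hTy (by rw [h]))
  have hon : ∀ t ∈ Ioo 0 L, ρ.exponent (γ t) < b ∧ Ω.bdryDist (γ t) < 1 := by
    intro t ht
    have h1 := hnbhd (γ t) ((hρ.dist_incl_le_length ha hγ (by positivity) hlen ht).trans_lt hδ1)
    exact ⟨h1.1, (Domain.bdryDist_le_dist (hρ.toInternal_notMem_range ha) _).trans_lt h1.2⟩
  have hDp : 0 < D ^ (1 + ε) := by positivity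
  -- The supremum need not be attained, so half of the height is given away.
  have hlt : ENNReal.ofReal (D ^ (1 + ε) / 2) < Ω.height γ L :=
    ((ENNReal.ofReal_lt_ofReal_iff hDp).2 (half_lt_self hDp)).trans_le hheight
  simp only [Domain.height, lt_iSup_iff] at hlt
  obtain ⟨t₀, ht₀, hlt⟩ := hlt
  set h := Ω.bdryDist (γ t₀) with hh
  have hDh : D ^ (1 + ε) / 2 < h := (ENNReal.ofReal_lt_ofReal_iff_of_nonneg (by positivity)).1 hlt
  have hh0 : 0 < h := (half_pos hDp).trans hDh
  -- Thus the arc of length `h / 2` that ends at parameter `t₀` lies within the curve.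
  have ht₀h : h ≤ t₀ := (Domain.bdryDist_le_dist (hρ.toInternal_notMem_range ha) _).trans
    (hγ.dist_source_le ht₀)
  have hlow : ENNReal.ofReal (2 ^ (-|b|) * h ^ b) * ENNReal.ofReal (h / 2) ≤ ρ.length γ L := by
    have hsub : Ioo (t₀ - h / 2) t₀ ⊆ Ioo 0 L := Ioo_subset_Ioo (by linarith) ht₀.2.le
    refine le_trans ?_ (lintegral_mono_set hsub)
    have : ENNReal.ofReal (h / 2) = volume (Ioo (t₀ - h / 2) t₀) := by
      rw [Real.volume_Ioo]
      congr 1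
      ring
    rw [this, ← setLIntegral_const]
    refine setLIntegral_mono' measurableSet_Ioo fun t ht => ENNReal.ofReal_le_ofReal ?_
    obtain ⟨h1, h2⟩ := hon t (hsub ht)
    have hd : dist (γ t : EuclideanSpace ℝ (Fin n)) (γ t₀) ≤ h / 2 := by
      refine (dist_le_dist_internalIncl _ _).trans ((dist_internalIncl_le hγ.unitSpeed ht.2.le
        (Icc_subset_Ioo (hsub ht).1 ht₀.2)).trans ?_)
      linarith [ht.1]
    have h3 := Domain.bdryDist_le_add (γ t₀) (γ t)
    have h4 := Domain.bdryDist_le_add (γ t) (γ t₀)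
    rw [dist_comm] at h3
    exact (two_rpow_mul_le hh0 (by linarith) (by linarith)).trans
      (rpow_bdryDist_lt_of_exponent_lt (by linarith) h2 h1).le
  have hmain : 2 ^ (-|b|) * h ^ b * (h / 2) ≤ dist a y ^ (1 - ε) := by
    have := hlow.trans hlen
    rwa [← ENNReal.ofReal_mul (by positivity), ENNReal.ofReal_le_ofReal_iff (by positivity)]
      at this
  have h5 : D ^ p ≤ C₀ * dist a y ^ (1 - ε) := by
    calc D ^ p = (D ^ (1 + ε)) ^ (1 + b) := by rw [hp, Real.rpow_mul hD0.le]
      _ ≤ (2 * h) ^ (1 + b) := by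
        refine Real.rpow_le_rpow hDp.le (by linarith) hb'.le
      _ = C₀ * (2 ^ (-|b|) * h ^ b * (h / 2)) := by
        have e : (2 : ℝ) ^ |b| * 2 ^ (-|b|) = 1 := by
          rw [← Real.rpow_add two_pos, add_neg_cancel, Real.rpow_zero]
        rw [Real.mul_rpow zero_le_two hh0.le, hC₀, Real.rpow_add hh0, Real.rpow_one]
        linear_combination (-(2 : ℝ) ^ (1 + b) * h * h ^ b) * e
      _ ≤ _ := by gcongr
  have h6 := Real.rpow_le_rpow (by positivity) h5 (inv_pos.2 hp0).le
  rw [Real.rpow_rpow_inv hD0.le hp0.ne', Real.mul_rpow hC₀0.le (by positivity),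
    ← Real.rpow_mul dist_nonneg, ← div_eq_mul_inv] at h6
  exact h6

end Weight

/-! ### Metric comparison from below: John curves -/

theorem Domain.dist_toEuclidean_le (w : Ω.Pt) (x : Ω.InternalClosure) :
    dist (w : EuclideanSpace ℝ (Fin n)) (Ω.toEuclidean x) ≤ dist (Ω.internalIncl w) x := by
  have := Ω.lipschitzWith_toEuclidean.dist_le_mul (Ω.internalIncl w) x
  rwa [Domain.toEuclidean_incl, NNReal.coe_one, one_mul] at this

/-- If the boundary distance vanished at the centre, the cone condition at the end of each John
curve would force length `0`. Then `Ω` would be a single point and its completion would add nothing.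
This also disposes of the default value `0` for an empty frontier. -/
theorem Domain.bdryDist_pos_of_john {α : ℝ} (hα : 0 < α) {x₀ : Ω.Pt}
    (hJ : ∀ x : Ω.Pt, ∃ (γ : ℝ → Ω.Pt) (L : ℝ), Ω.IsCurve γ L x x₀ ∧
      ∀ t ∈ Icc (0 : ℝ) L, α * t ≤ Ω.bdryDist (γ t))
    {ρ : Weight Ω} (hb : ρ.boundary.Nonempty) : 0 < Ω.bdryDist x₀ := by
  by_contra! hle
  have hall : ∀ x : Ω.Pt, x = x₀ := by
    intro x
    obtain ⟨γ, L, hγ, hd⟩ := hJ x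
    have h1 := hd L (right_mem_Icc.2 hγ.length_nonneg)
    rw [hγ.target] at h1
    have hL : L = 0 := le_antisymm (by nlinarith) hγ.length_nonneg
    rw [← hγ.source, ← hγ.target, hL]
  obtain ⟨a, ha⟩ := hb
  obtain ⟨u, hu⟩ := ρ.exists_seq_tendsto a
  simp only [hall (u _)] at hu
  exact ha ⟨x₀, tendsto_nhds_unique tendsto_const_nhds hu⟩

theorem setLIntegral_rpow_add_const {β r c K : ℝ} (hβ : -1 < β) (hr : 0 < r) (hc : 0 < c)
    (hK : 0 ≤ K) : ∫⁻ t in Ioo 0 r, ENNReal.ofReal ((c * t) ^ β + K) =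
      ENNReal.ofReal (c ^ β * (r ^ (1 + β) / (1 + β)) + r * K) := by
  have hint : IntegrableOn (fun t : ℝ => (c * t) ^ β + K) (Ioo 0 r) := by
    have h1 : IntegrableOn (fun t : ℝ => c ^ β * t ^ β + K) (Ioo 0 r) :=
      ((((intervalIntegral.intervalIntegrable_rpow' hβ (a := 0) (b := r)).1).mono_set
        Ioo_subset_Ioc_self).const_mul _).add (integrableOn_const (by simp))
    refine h1.congr_fun (fun t ht => ?_) measurableSet_Ioo
    simp only [Real.mul_rpow hc.le ht.1.le]
  rw [← ofReal_integral_eq_lintegral_ofReal hint]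
  · congr 1
    rw [← integral_Ioc_eq_integral_Ioo, ← intervalIntegral.integral_of_le hr.le]
    rw [intervalIntegral.integral_congr (g := fun t => c ^ β * t ^ β + K) fun t ht => by
      rw [uIcc_of_le hr.le] at ht
      simp only [Real.mul_rpow hc.le ht.1]]
    rw [intervalIntegral.integral_add
      ((intervalIntegral.intervalIntegrable_rpow' hβ).const_mul _) (by simp),
      intervalIntegral.integral_const_mul, integral_rpow (Or.inl hβ),
      intervalIntegral.integral_const, Real.zero_rpow (by linarith), add_comm β 1]
    simp
  · filter_upwards [ae_restrict_mem measurableSet_Ioo] with t ht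
    have := ht.1
    simp only [Pi.zero_apply]
    positivity

namespace Weight

variable {ρ : Weight Ω}

/-- The growth bound for `ρ` near a boundary point `x` given by a lower bound `β` for the
exponents at distance less than `δ` from `x`. -/
theorem toFun_le_of_lt_exponent {x : Ω.InternalClosure} (hx : x ∉ range Ω.internalIncl) {β δ : ℝ}
    (h : ∀ w, dist (Ω.internalIncl w) x < δ → (β : EReal) < ρ.exponent w) {R m : ℝ} (hRδ : R < δ)
    (hR1 : R < 1) (hm : 0 < m) {w : Ω.Pt} (hw : dist (Ω.internalIncl w) x ≤ R)
    (hmw : m ≤ Ω.bdryDist w) : ρ.toFun w ≤ m ^ β + R ^ β := by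
  have h0 : 0 < Ω.bdryDist w := hm.trans_le hmw
  have hdR : Ω.bdryDist w ≤ R := (Domain.bdryDist_le_dist hx w).trans hw
  have hR : 0 < R := h0.trans_le hdR
  refine (lt_rpow_bdryDist_of_lt_exponent h0 (hdR.trans_lt hR1) (h w (hw.trans_lt hRδ))).le.trans ?_
  -- As `m ≤ d(w) ≤ R`, the power is largest at one of the two ends; the sum covers both signs of
  -- `β`.
  rcases le_total 0 β with hβ | hβ
  · have := Real.rpow_le_rpow h0.le hdR hβ
    have : 0 ≤ m ^ β := by positivity
    linarith
  · have := Real.rpow_le_rpow_of_nonpos hm hmw hβ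
    have : 0 ≤ R ^ β := by positivity
    linarith

theorem IsDensity.exists_near (hρ : ρ.IsDensity) (a : ρ.Closure) {s r : ℝ} (hs : 0 < s)
    (hr : 0 < r) : ∃ x : Ω.Pt, dist (ρ.incl x) a < s ∧
      dist (Ω.internalIncl x) (ρ.toInternal a) < r := by
  obtain ⟨u, hu⟩ := ρ.exists_seq_tendsto a
  have h1 := (hρ.tendsto_toInternal a).comp (tendsto_comap_iff.2 hu)
  obtain ⟨i, hi1, hi2⟩ := ((hu.eventually (Metric.ball_mem_nhds a hs)).and
    (h1.eventually (Metric.ball_mem_nhds _ hr))).exists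
  exact ⟨u i, hi1, hi2⟩

/-- A boundary point is close, in both metrics, to a point whose distance to the boundary is
comparable to the scale. -/
theorem IsDensity.exists_inner_point (hρ : ρ.IsDensity) {α : ℝ} (hα : 0 < α) {x₀ : Ω.Pt}
    (hJ : ∀ x : Ω.Pt, ∃ (γ : ℝ → Ω.Pt) (L : ℝ), Ω.IsCurve γ L x x₀ ∧
      ∀ t ∈ Icc (0 : ℝ) L, α * t ≤ Ω.bdryDist (γ t))
    {β δ : ℝ} (hβ : -1 < β) {a : ρ.Closure} (ha : a ∈ ρ.boundary)
    (h : ∀ w, dist (Ω.internalIncl w) (ρ.toInternal a) < δ → (β : EReal) < ρ.exponent w)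
    {r : ℝ} (hr : 0 < r) (hrδ : 3 * r < δ) (hr1 : 3 * r < 1) (hrx : 2 * r < Ω.bdryDist x₀) :
    ∃ z : Ω.Pt, α * r ≤ Ω.bdryDist z ∧ dist (Ω.internalIncl z) (ρ.toInternal a) ≤ 2 * r ∧
      dist (ρ.incl z) a ≤ (α ^ β / (1 + β) + 3 ^ β + 1) * r ^ (1 + β) := by
  have hTa := hρ.toInternal_notMem_range ha
  obtain ⟨x, hx1, hx2⟩ := hρ.exists_near a (s := r ^ (1 + β)) (by positivity) hr
  obtain ⟨γ, L, hγ, hcone⟩ := hJ x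
  -- A shorter curve would place the centre within `2 * r` of a boundary point.
  have hrL : r ≤ L := by
    by_contra! hlt
    have h1 := Domain.bdryDist_le_dist hTa x₀
    have h2 := dist_internalIncl_le hγ.unitSpeed hγ.length_nonneg subset_rfl
    rw [hγ.source, hγ.target, sub_zero, dist_comm] at h2
    have h3 := dist_triangle (Ω.internalIncl x₀) (Ω.internalIncl x) (ρ.toInternal a)
    linarith
  have hdist : ∀ t ∈ Icc 0 r, dist (Ω.internalIncl (γ t)) (ρ.toInternal a) ≤ 2 * r := by
    intro t ht
    have h2 := dist_internalIncl_le hγ.unitSpeed ht.1 (Icc_subset_Icc_right (ht.2.trans hrL))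
    rw [hγ.source, dist_comm] at h2
    have h3 := dist_triangle (Ω.internalIncl (γ t)) (Ω.internalIncl x) (ρ.toInternal a)
    linarith [ht.2]
  refine ⟨γ r, hcone r ⟨hr.le, hrL⟩, hdist r (right_mem_Icc.2 hr.le), ?_⟩
  have hb : 0 < 1 + β := by linarith
  have hlen : dist (ρ.incl x) (ρ.incl (γ r)) ≤
      α ^ β * (r ^ (1 + β) / (1 + β)) + r * (3 * r) ^ β := by
    refine ρ.dist_incl_le_of_eDist_le (by positivity) ?_
    have h1 := ρ.eDist_le_setLIntegral hγ.unitSpeed hr.le (Icc_subset_Icc_right hrL)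
    rw [hγ.source] at h1
    rw [← setLIntegral_rpow_add_const hβ hr hα (by positivity)]
    refine h1.trans (setLIntegral_mono' measurableSet_Ioo fun t ht => ENNReal.ofReal_le_ofReal ?_)
    refine toFun_le_of_lt_exponent hTa h hrδ hr1 (mul_pos hα ht.1) ?_
      (hcone t ⟨ht.1.le, ht.2.le.trans hrL⟩)
    linarith [hdist t (Ioo_subset_Icc_self ht)]
  have h4 := dist_triangle_left (ρ.incl (γ r)) a (ρ.incl x)
  have e : r * (3 * r) ^ β = 3 ^ β * r ^ (1 + β) := by
    rw [Real.mul_rpow (by norm_num) hr.le, Real.rpow_add hr, Real.rpow_one]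
    ring
  rw [e] at hlen
  calc _ ≤ _ := h4
    _ ≤ (α ^ β * (r ^ (1 + β) / (1 + β)) + 3 ^ β * r ^ (1 + β)) + r ^ (1 + β) := by linarith
    _ = _ := by ring

/-- Boundary points are grouped by the position of their inner points `z`. Measuring in Euclidean
space supplies the compactness that bounds the number of groups, and also the dimension bound by `n`
needed later. -/
theorem IsDensity.isHolderTransfer (hρ : ρ.IsDensity) (hΩ : Ω.IsJohn) {β δ : ℝ} (hβ : -1 < β)
    (hδ : 0 < δ) {P : Set ρ.Closure} (hP : P ⊆ ρ.boundary)
    (h : ∀ a ∈ P, ∀ w, dist (Ω.internalIncl w) (ρ.toInternal a) < δ →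
      (β : EReal) < ρ.exponent w) :
    IsHolderTransfer (1 + β) id (Ω.toEuclidean ∘ ρ.toInternal) P := by
  obtain ⟨α, hα, hα1, x₀, hJ⟩ := hΩ
  have hx₀ := Domain.bdryDist_pos_of_john hα hJ hρ.boundary_nonempty
  -- At scale `r`, radius `3` allows `2` from `z` to its boundary point and `1` for the diameter of
  -- `T`. Radius `α / 4` puts two inner points of one group within `α * r / 2`, half the lower bound
  -- for their boundary distance.
  obtain ⟨t, -, htfin, htcov⟩ := finite_cover_balls_of_compact
    (isCompact_closedBall (0 : EuclideanSpace ℝ (Fin n)) 3) (show 0 < α / 4 by positivity)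
  obtain ⟨m, ⟨c⟩⟩ : ∃ m, Nonempty (t ≃ Fin m) :=
    ⟨htfin.toFinset.card, ⟨(Equiv.setCongr (by simp)).trans htfin.toFinset.equivFin⟩⟩
  set C₁ : ℝ := α ^ β / (1 + β) + 3 ^ β + 1 with hC₁
  have hb : 0 < 1 + β := by linarith
  have hC₁0 : 0 < C₁ := by positivity
  set C₂ : ℝ := (α / 2) ^ β + 3 ^ β with hC₂
  have hC₂0 : 0 < C₂ := by positivity
  refine ⟨m, 2 * C₁ + C₂, min (δ / 3) (min (1 / 3) (Ω.bdryDist x₀ / 2)), by positivity,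
    by positivity, fun r hr hrr T hT hdiam => ?_⟩
  have hrδ : 3 * r < δ := by linarith [hrr.trans_le (min_le_left _ _)]
  have hr1 : 3 * r < 1 := by
    linarith [hrr.trans_le ((min_le_right _ _).trans (min_le_left _ _))]
  have hrx : 2 * r < Ω.bdryDist x₀ := by
    linarith [hrr.trans_le ((min_le_right _ _).trans (min_le_right _ _))]
  rcases T.eq_empty_or_nonempty with rfl | ⟨a₀, ha₀⟩
  · exact ⟨fun _ => ∅, by simp, by simp⟩
  have : Nonempty Ω.Pt := ⟨x₀⟩
  choose! z hz1 hz2 hz3 using fun a (ha : a ∈ T) =>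
    hρ.exists_inner_point hα hJ hβ (hP (hT ha)) (h a (hT ha)) hr hrδ hr1 hrx
  set v := Ω.toEuclidean ∘ ρ.toInternal with hv
  refine ⟨fun j => {a ∈ T | dist (z a : EuclideanSpace ℝ (Fin n))
    (v a₀ + r • (c.symm j : EuclideanSpace ℝ (Fin n))) < r * (α / 4)}, ?_, ?_⟩
  · intro a ha
    have h1 : dist (z a : EuclideanSpace ℝ (Fin n)) (v a₀) ≤ 3 * r := by
      have h2 := (Domain.dist_toEuclidean_le (z a) (ρ.toInternal a)).trans (hz2 a ha)
      have h3 := dist_triangle (z a : EuclideanSpace ℝ (Fin n)) (v a) (v a₀)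
      have h4 := hdiam a ha a₀ ha₀
      have h5 : v a = Ω.toEuclidean (ρ.toInternal a) := rfl
      rw [← h5] at h2
      linarith
    have h2 : r⁻¹ • ((z a : EuclideanSpace ℝ (Fin n)) - v a₀) ∈
        Metric.closedBall (0 : EuclideanSpace ℝ (Fin n)) 3 := by
      rw [mem_closedBall_zero_iff, norm_smul, norm_inv, Real.norm_of_nonneg hr.le,
        ← dist_eq_norm, inv_mul_le_iff₀ hr]
      linarith
    obtain ⟨y, hy, hyd⟩ := mem_iUnion₂.1 (htcov h2)
    refine mem_iUnion.2 ⟨c ⟨y, hy⟩, ha, ?_⟩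
    rw [Equiv.symm_apply_apply]
    rw [Metric.mem_ball, dist_eq_norm] at hyd
    have e : (z a : EuclideanSpace ℝ (Fin n)) - (v a₀ + r • y) =
        r • (r⁻¹ • ((z a : EuclideanSpace ℝ (Fin n)) - v a₀) - y) := by
      rw [smul_sub, smul_inv_smul₀ hr.ne']
      abel
    rw [dist_eq_norm, e, norm_smul, Real.norm_of_nonneg hr.le]
    exact mul_lt_mul_of_pos_left hyd hr
  · rintro j a ⟨ha, haj⟩ b ⟨hb', hbj⟩
    have hab : dist (z a : EuclideanSpace ℝ (Fin n)) (z b) < α * r / 2 := by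
      have := dist_triangle_right (z a : EuclideanSpace ℝ (Fin n)) (z b)
        (v a₀ + r • (c.symm j : EuclideanSpace ℝ (Fin n)))
      linarith
    have hseg : ∀ w ∈ segment ℝ (z a : EuclideanSpace ℝ (Fin n)) (z b),
        dist (z a : EuclideanSpace ℝ (Fin n)) w < α * r / 2 := by
      intro w hw
      rw [dist_comm]
      refine (convex_ball (z a : EuclideanSpace ℝ (Fin n)) (α * r / 2)).segment_subset
        (Metric.mem_ball_self (by positivity)) ?_ hw
      rw [Metric.mem_ball']
      exact hab
    have hmem : ∀ w ∈ segment ℝ (z a : EuclideanSpace ℝ (Fin n)) (z b), w ∈ Ω.carrier := by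
      intro w hw
      refine Domain.ball_bdryDist_subset (z a) (Metric.mem_ball'.2 ?_)
      have : 0 < α * r := by positivity
      linarith [hseg w hw, hz1 a ha]
    have hρw : ∀ w ∈ segment ℝ (z a : EuclideanSpace ℝ (Fin n)) (z b),
        ∃ hw : w ∈ Ω.carrier, ρ.toFun ⟨w, hw⟩ ≤ C₂ * r ^ β := by
      intro w hw
      have hwΩ := hmem w hw
      refine ⟨hwΩ, ?_⟩
      have hd : dist (Ω.internalIncl ⟨w, hwΩ⟩) (Ω.internalIncl (z a)) ≤ r := by
        refine dist_incl_le_of_eDist_le _ hr.le ((Ω.unitWeight.eDist_le_of_segment ⟨w, hwΩ⟩ (z a)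
          zero_le_one fun y hy => ⟨hmem y ?_, le_rfl⟩).trans (ENNReal.ofReal_le_ofReal ?_))
        · exact (convex_segment _ _).segment_subset hw (left_mem_segment ℝ _ _) hy
        · rw [one_mul, dist_comm]
          have h1 := hseg w hw
          have h2 : α * r ≤ 1 * r := by gcongr
          linarith
      have h1 := toFun_le_of_lt_exponent (hρ.toInternal_notMem_range (hP (hT ha))) (h a (hT ha))
        hrδ hr1 (m := α / 2 * r) (by positivity) (w := ⟨w, hwΩ⟩)
        (by
          have := dist_triangle (Ω.internalIncl ⟨w, hwΩ⟩) (Ω.internalIncl (z a)) (ρ.toInternal a)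
          linarith [hz2 a ha])
        (by
          have h2 := Domain.bdryDist_le_add (z a) ⟨w, hwΩ⟩
          have h3 := hseg w hw
          simp only at h2
          linarith [hz1 a ha])
      rw [Real.mul_rpow (by positivity) hr.le, Real.mul_rpow (by norm_num) hr.le, ← add_mul] at h1
      exact h1
    have hzz : dist (ρ.incl (z a)) (ρ.incl (z b)) ≤ C₂ * r ^ (1 + β) := by
      refine ρ.dist_incl_le_of_eDist_le (by positivity)
        ((ρ.eDist_le_of_segment (z a) (z b) (by positivity) hρw).trans
          (ENNReal.ofReal_le_ofReal ?_))
      have h2 : α * r ≤ 1 * r := by gcongr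
      have h3 : dist (z a : EuclideanSpace ℝ (Fin n)) (z b) ≤ r := by linarith
      calc _ ≤ C₂ * r ^ β * r := by gcongr
        _ = _ := by rw [Real.rpow_add hr, Real.rpow_one]; ring
    have h2 := hz3 a ha
    have h3 := hz3 b hb'
    simp only [id]
    have h4 := dist_triangle4 a (ρ.incl (z a)) (ρ.incl (z b)) b
    rw [dist_comm a (ρ.incl (z a))] at h4
    rw [← hC₁] at h2 h3
    linarith

end Weight

/-! ### Decomposition of the boundary -/

theorem mul_le_of_forall_le_div {x y : ℝ≥0∞} {c : ℝ≥0} (hc : 0 < c)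
    (h : ∀ κ : ℝ≥0, 0 < κ → κ < c → x ≤ y / κ) : x * c ≤ y := by
  have : (𝓝[<] c).NeBot := nhdsLT_neBot_of_exists_lt ⟨0, hc⟩
  have h1 : Tendsto (fun κ : ℝ≥0 => x * (κ : ℝ≥0∞)) (𝓝[<] c) (𝓝 (x * c)) :=
    ENNReal.Tendsto.const_mul ((ENNReal.tendsto_coe.2 tendsto_id).mono_left nhdsWithin_le_nhds)
      (Or.inl (by exact_mod_cast hc.ne'))
  refine le_of_tendsto h1 ?_
  filter_upwards [Ioo_mem_nhdsLT hc] with κ hκ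
  exact ENNReal.mul_le_of_le_div (h κ hκ.1 hκ.2)

theorem Domain.eventually_approach {x : Ω.InternalClosure} {p : Ω.Pt → Prop}
    (h : ∀ᶠ w in Ω.approach x, p w) :
    ∃ m : ℕ, ∀ w, dist (Ω.internalIncl w) x < 1 / ((m : ℝ) + 1) → p w := by
  obtain ⟨r, hr, h2⟩ := (Metric.nhds_basis_ball.comap Ω.internalIncl).eventually_iff.1 h
  obtain ⟨m, hm⟩ := exists_nat_one_div_lt hr
  exact ⟨m, fun w hw => h2 (hw.trans hm)⟩

namespace Weight

variable {ρ : Weight Ω}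

theorem exists_sublevelPlus_pieces (hρ : ρ.IsDensity) (hGH : ρ.GehringHayman) {β : ℝ}
    (hβ : -1 < β) {κ : ℝ} (hκ : 0 < κ) (hκβ : κ < (1 + β)⁻¹) :
    ∃ P : ℕ → Set ρ.Closure, (∀ m, P m ⊆ ρ.boundary) ∧
      ρ.sublevelPlus β ⊆ (⋃ m, ρ.toInternal '' P m) ∧
      ∀ m, IsHolderTransfer κ ρ.toInternal id (P m) := by
  refine ⟨fun m => {a ∈ ρ.boundary | ∀ y, dist a y < 1 / ((m : ℝ) + 1) →
    dist (ρ.toInternal a) (ρ.toInternal y) ≤ ((m : ℝ) + 1) * dist a y ^ κ},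
    fun m => sep_subset _ _, ?_, fun m => ?_⟩
  · rintro _ ⟨⟨a, ha, rfl⟩, hi⟩
    -- The same `ε` is the loss in the Gehring–Hayman condition and the room above `β`; as `ε → 0`
    -- the exponent tends to `1 / (1 + β) > κ`.
    obtain ⟨ε, hκε, hε0, hε1⟩ : ∃ ε : ℝ,
        κ < (1 - ε) / ((1 + ε) * (1 + (β + ε))) ∧ 0 < ε ∧ ε < 1 := by
      have hcont : ContinuousAt (fun ε : ℝ => (1 - ε) / ((1 + ε) * (1 + (β + ε)))) 0 := by
        refine ContinuousAt.div (by fun_prop) (by fun_prop) ?_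
        simp only [add_zero, one_mul]
        linarith
      have hev := hcont.eventually (lt_mem_nhds (a := κ) (by simpa using hκβ))
      exact ((hev.filter_mono (nhdsWithin_le_nhds (s := Ioi 0))).and
        (Ioo_mem_nhdsGT one_pos)).exists
    obtain ⟨C, r, hC, hr, hle⟩ := hGH.dist_toInternal_le hρ ha (b := β + ε) (by linarith)
      (hi.trans_lt (EReal.coe_lt_coe_iff.2 (by linarith))) hε0 hε1
    obtain ⟨m₁, hm₁⟩ := exists_nat_gt C
    obtain ⟨m₂, hm₂⟩ := exists_nat_one_div_lt hr
    refine mem_iUnion.2 ⟨max m₁ m₂, mem_image_of_mem _ ⟨ha, fun y hy => ?_⟩⟩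
    have hM₁ : (m₁ : ℝ) ≤ (max m₁ m₂ : ℕ) := by exact_mod_cast le_max_left _ _
    have hM₂ : (m₂ : ℝ) ≤ (max m₁ m₂ : ℕ) := by exact_mod_cast le_max_right _ _
    have h1 : dist a y < r :=
      (hy.trans_le (one_div_le_one_div_of_le (by positivity) (by linarith))).trans hm₂
    have h2 : dist a y ≤ 1 := by
      refine hy.le.trans ((div_le_one (by positivity)).2 ?_)
      have : (0 : ℝ) ≤ (max m₁ m₂ : ℕ) := Nat.cast_nonneg _
      linarith
    refine (hle y h1).trans (mul_le_mul (by linarith) ?_ (by positivity) (by positivity))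
    exact Real.rpow_le_rpow_of_exponent_ge' dist_nonneg h2 hκ.le hκε.le
  · refine isHolderTransfer_of_dist_le hκ.le (C := (m : ℝ) + 1) (r₀ := 1 / ((m : ℝ) + 1))
      (by positivity) (by positivity) fun a ha b _ hab => ha.2 b hab

/-- The lower bound for any notion of dimension that is monotone, countably stable and compatible
with Hölder conditions. -/
theorem iSup_sublevelPlus_le (hρ : ρ.IsDensity) (hGH : ρ.GehringHayman)
    {D : Set ρ.Closure → ℝ≥0∞} {D' : Set Ω.InternalClosure → ℝ≥0∞} (hDmono : Monotone D)
    (hmono : Monotone D')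
    (hunion : ∀ (A : ℕ → Set Ω.InternalClosure) (c : ℝ≥0∞), (∀ i, D' (A i) ≤ c) →
      D' (⋃ i, A i) ≤ c)
    (htrans : ∀ (κ : ℝ≥0) (P : Set ρ.Closure), 0 < κ → IsHolderTransfer κ ρ.toInternal id P →
      D' (ρ.toInternal '' P) ≤ D P / κ) :
    (⨆ (β : ℝ) (_ : -1 < β), D' (ρ.sublevelPlus β) / ENNReal.ofReal (1 + β)) ≤
      D ρ.boundary := by
  refine iSup₂_le fun β hβ => ?_
  have hpos : 0 < 1 + β := by linarith
  rw [ENNReal.div_eq_inv_mul, mul_comm, ← ENNReal.ofReal_inv_of_pos hpos]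
  refine mul_le_of_forall_le_div (c := (1 + β)⁻¹.toNNReal)
    (Real.toNNReal_pos.2 (inv_pos.2 hpos)) fun κ hκ hκβ => ?_
  obtain ⟨P, hP, hcov, hH⟩ := exists_sublevelPlus_pieces hρ hGH hβ (κ := κ) hκ
    (Real.lt_toNNReal_iff_coe_lt.1 hκβ)
  refine (hmono hcov).trans (hunion _ _ fun m => (htrans κ _ hκ (hH m)).trans ?_)
  exact ENNReal.div_le_div_right (hDmono (hP m)) _

/-- The upper bound for any notion of dimension that is monotone, countably stable and compatible
with Hölder conditions up to finite subdivision. -/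
theorem le_iSup_sublevelMinus (hρ : ρ.IsDensity) (hΩ : Ω.IsJohn)
    {D : Set ρ.Closure → ℝ≥0∞} {D' : Set Ω.InternalClosure → ℝ≥0∞} (hDmono : Monotone D)
    (hmono : Monotone D')
    (hunion : ∀ (A : (ℚ × ℚ × ℕ) ⊕ ℕ → Set ρ.Closure) (c : ℝ≥0∞), (∀ i, D (A i) ≤ c) →
      D (⋃ i, A i) ≤ c)
    (htrans : ∀ (κ : ℝ≥0) (P : Set ρ.Closure), 0 < κ →
      IsHolderTransfer κ id (Ω.toEuclidean ∘ ρ.toInternal) P →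
      D P ≤ D' (ρ.toInternal '' P) / κ ∧ D P ≤ n / κ) :
    D ρ.goodBoundary ≤
      ⨆ (β : ℝ) (_ : -1 < β), D' (ρ.sublevelMinus β) / ENNReal.ofReal (1 + β) := by
  set M := ⨆ (β : ℝ) (_ : -1 < β), D' (ρ.sublevelMinus β) / ENNReal.ofReal (1 + β) with hM
  -- Finiteness of `M` is needed for the final limit, in which the factor of `M` tends to `1`.
  rcases eq_or_ne M ⊤ with hMtop | hMtop
  · rw [hMtop]
    exact le_top
  let near : ℝ → ℕ → Set ρ.Closure := fun β m => {a ∈ ρ.boundary | ∀ w,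
    dist (Ω.internalIncl w) (ρ.toInternal a) < 1 / ((m : ℝ) + 1) → (β : EReal) < ρ.exponent w}
  have htr : ∀ β, -1 < β → ∀ m, ∀ P ⊆ near β m,
      D P ≤ D' (ρ.toInternal '' P) / ENNReal.ofReal (1 + β) ∧
        D P ≤ n / ENNReal.ofReal (1 + β) := by
    intro β hβ m P hP
    refine htrans (1 + β).toNNReal P (Real.toNNReal_pos.2 (by linarith)) ?_
    rw [Real.coe_toNNReal _ (by linarith)]
    exact hρ.isHolderTransfer hΩ hβ (δ := 1 / ((m : ℝ) + 1)) (by positivity)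
      (fun a ha => (hP ha).1) fun a ha => (hP ha).2
  have key : ∀ q : ℝ, 1 < q → ∀ K : ℕ, D ρ.goodBoundary ≤
      ENNReal.ofReal q * M + n / ENNReal.ofReal (1 + K) := by
    intro q hq K
    -- In a piece `(β', β, m)` the lower bound `β'` gives the Hölder exponent and the upper bound
    -- `β` gives membership in the sublevel set; replacing `1 + β'` by `1 + β` costs a factor of at
    -- most `q`. The pieces on the right cover the points with `i⁻ > K`, including `i⁻ = ∞`.
    let A : (ℚ × ℚ × ℕ) ⊕ ℕ → Set ρ.Closure := Sum.elim
      (fun p => {a ∈ near p.1 p.2.2 | ρ.iMinus (ρ.toInternal a) ≤ ((p.2.1 : ℝ) : EReal) ∧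
        (-1 : ℝ) < p.1 ∧ (-1 : ℝ) < p.2.1 ∧ (1 + p.2.1 : ℝ) ≤ q * (1 + p.1)})
      (fun m => near K m)
    have hcov : ρ.goodBoundary ⊆ ⋃ i, A i := by
      rintro a ⟨ha, hi⟩
      rcases lt_or_ge ((K : ℝ) : EReal) (ρ.iMinus (ρ.toInternal a)) with hlt | hle
      · obtain ⟨m, hm⟩ := Domain.eventually_approach (eventually_lt_of_lt_liminf hlt)
        exact mem_iUnion.2 ⟨Sum.inr m, ha, hm⟩
      · obtain ⟨x, hx⟩ : ∃ x : ℝ, ρ.iMinus (ρ.toInternal a) = x :=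
          ⟨_, (EReal.coe_toReal (hle.trans_lt (EReal.coe_lt_top _)).ne
            ((bot_le.trans_lt hi).ne')).symm⟩
        have hx1 : -1 < x := by
          rw [hx] at hi
          exact EReal.coe_lt_coe_iff.1 hi
        have hq0 : 0 < q := one_pos.trans hq
        obtain ⟨β', h1, h2⟩ := exists_rat_btwn (show (1 + x) / q - 1 < x by
          rw [sub_lt_iff_lt_add, div_lt_iff₀ hq0]
          nlinarith)
        have h3 : 1 + x < q * (1 + β') := by
          rw [sub_lt_iff_lt_add, div_lt_iff₀ hq0] at h1
          linarith
        obtain ⟨β, h4, h5⟩ := exists_rat_btwn (show x < q * (1 + β') - 1 by linarith)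
        obtain ⟨m, hm⟩ := Domain.eventually_approach (x := ρ.toInternal a)
          (eventually_lt_of_lt_liminf (show ((β' : ℝ) : EReal) < ρ.iMinus (ρ.toInternal a) by
            rw [hx]
            exact EReal.coe_lt_coe_iff.2 h2))
        refine mem_iUnion.2 ⟨Sum.inl (β', β, m), ⟨ha, hm⟩, ?_, ?_, hx1.trans h4, by linarith⟩
        · rw [hx]
          exact EReal.coe_le_coe_iff.2 h4.le
        · have : 0 < (1 + x) / q := div_pos (by linarith) hq0
          linarith
    refine (hDmono hcov).trans (hunion A _ ?_)
    have hK : -1 < (K : ℝ) := by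
      have : (0 : ℝ) ≤ K := Nat.cast_nonneg K
      linarith
    rintro (⟨β', β, m⟩ | m)
    · by_cases hc : (-1 : ℝ) < β' ∧ (-1 : ℝ) < β ∧ (1 + β : ℝ) ≤ q * (1 + β')
      · obtain ⟨hβ', hβ, hββ⟩ := hc
        refine le_trans ?_ le_self_add
        refine (htr β' hβ' m _ (sep_subset _ _)).1.trans ?_
        have h1 : D' (ρ.toInternal '' A (Sum.inl (β', β, m))) ≤ D' (ρ.sublevelMinus β) := by
          refine hmono ?_
          rintro _ ⟨a, ha, rfl⟩
          exact ⟨mem_image_of_mem _ ha.1.1, ha.2.1⟩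
        have h2 : D' (ρ.sublevelMinus β) / ENNReal.ofReal (1 + β) ≤ M :=
          le_iSup₂ (f := fun (β : ℝ) (_ : -1 < β) =>
            D' (ρ.sublevelMinus β) / ENNReal.ofReal (1 + β)) (β : ℝ) hβ
        have hb : ENNReal.ofReal (1 + β) ≠ 0 := (ENNReal.ofReal_pos.2 (by linarith)).ne'
        have hb' : ENNReal.ofReal (1 + β') ≠ 0 := (ENNReal.ofReal_pos.2 (by linarith)).ne'
        rw [ENNReal.div_le_iff hb ENNReal.ofReal_ne_top] at h2
        refine (ENNReal.div_le_div_right h1 _).trans ?_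
        rw [ENNReal.div_le_iff hb' ENNReal.ofReal_ne_top]
        calc _ ≤ M * ENNReal.ofReal (1 + β) := h2
          _ ≤ M * ENNReal.ofReal (q * (1 + β')) := by gcongr
          _ = _ := by rw [ENNReal.ofReal_mul (by linarith)]; ring
      · have : A (Sum.inl (β', β, m)) = ∅ := by
          ext a
          simp only [mem_empty_iff_false, iff_false]
          exact fun ha => hc ha.2.2
        rw [this]
        exact (htr K hK 0 ∅ (empty_subset _)).2.trans le_add_self
    · exact (htr K hK m _ subset_rfl).2.trans le_add_self
  -- One parameter drives both limits: `q = 1 + 1 / (K + 1)` tends to `1` while `K → ∞`.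
  have hlim : Tendsto (fun K : ℕ => ENNReal.ofReal (1 + 1 / ((K : ℝ) + 1)) * M +
      n / ENNReal.ofReal (1 + K)) atTop (𝓝 (ENNReal.ofReal (1 + 0) * M + 0)) := by
    refine Tendsto.add (ENNReal.Tendsto.mul_const (ENNReal.tendsto_ofReal
      (tendsto_const_nhds.add tendsto_one_div_add_atTop_nhds_zero_nat)) (Or.inr hMtop)) ?_
    have h1 : Tendsto (fun K : ℕ => ENNReal.ofReal (1 + K)) atTop (𝓝 ⊤) :=
      ENNReal.tendsto_ofReal_nhds_top.2
        (tendsto_atTop_add_const_left _ _ tendsto_natCast_atTop_atTop)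
    have h2 := ENNReal.Tendsto.const_div (a := (n : ℝ≥0∞)) h1 (Or.inr (by simp))
    simpa using h2
  simp only [add_zero, ENNReal.ofReal_one, one_mul] at hlim
  refine ge_of_tendsto hlim (Eventually.of_forall fun K => key _ ?_ K)
  have : (0 : ℝ) < 1 / ((K : ℝ) + 1) := by positivity
  linarith

end Weight

end DensityMetric

/-! ### The four inequalities for Hausdorff and packing dimension. -/

theorem theorem4p2 {n : ℕ} (Ω : DensityMetric.Domain n) (hΩ : Ω.IsJohn)
    (ρ : DensityMetric.Weight Ω) (hρ : ρ.IsDensity) (hGH : ρ.GehringHayman) :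
    (⨆ (β : ℝ) (_ : -1 < β), ρ.dPlus β / ENNReal.ofReal (1 + β)) ≤ dimH ρ.boundary ∧
    (⨆ (β : ℝ) (_ : -1 < β), ρ.DPlus β / ENNReal.ofReal (1 + β)) ≤
      DensityMetric.dimP ρ.boundary ∧
    dimH ρ.goodBoundary ≤ (⨆ (β : ℝ) (_ : -1 < β), ρ.dMinus β / ENNReal.ofReal (1 + β)) ∧
    DensityMetric.dimP ρ.goodBoundary ≤
      (⨆ (β : ℝ) (_ : -1 < β), ρ.DMinus β / ENNReal.ofReal (1 + β)) := by
  -- The upper transfer yields dimensions of Euclidean images; a `1`-Lipschitz projection bounds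
  -- these by internal dimensions.
  have hH : ∀ S : Set Ω.InternalClosure, dimH (Ω.toEuclidean '' S) ≤ dimH S :=
    Ω.lipschitzWith_toEuclidean.dimH_image_le
  have hP : ∀ S : Set Ω.InternalClosure,
      DensityMetric.dimP (Ω.toEuclidean '' S) ≤ DensityMetric.dimP S :=
    DensityMetric.dimP_image_le_of_lipschitz Ω.lipschitzWith_toEuclidean
  have hHn : ∀ S : Set (EuclideanSpace ℝ (Fin n)), dimH S ≤ n := fun S =>
    (dimH_mono S.subset_univ).trans (by simp [Real.dimH_univ_eq_finrank])
  have hPn : ∀ S : Set (EuclideanSpace ℝ (Fin n)), DensityMetric.dimP S ≤ n := fun S => by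
    simpa using DensityMetric.dimP_le_finrank S
  refine ⟨?_, ?_, ?_, ?_⟩
  · refine DensityMetric.Weight.iSup_sublevelPlus_le hρ hGH (fun _ _ h => dimH_mono h)
      (D' := dimH) (fun _ _ h => dimH_mono h) (fun A c h => ?_) fun κ P hκ h => ?_
    · rw [dimH_iUnion]
      exact iSup_le h
    · simpa using h.dimH_le hκ
  · refine DensityMetric.Weight.iSup_sublevelPlus_le hρ hGH
      (fun _ _ h => DensityMetric.dimP_mono h)
      (D' := DensityMetric.dimP) (fun _ _ h => DensityMetric.dimP_mono h)
      (fun A c h => DensityMetric.dimP_iUnion_le A h) fun κ P hκ h => ?_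
    simpa using h.dimP_le hκ
  · refine DensityMetric.Weight.le_iSup_sublevelMinus hρ hΩ (fun _ _ h => dimH_mono h)
      (D' := dimH) (fun _ _ h => dimH_mono h) (fun A c h => ?_) fun κ P hκ h => ?_
    · rw [dimH_iUnion]
      exact iSup_le h
    · have h1 := h.dimH_le hκ
      rw [Set.image_id] at h1
      refine ⟨h1.trans (ENNReal.div_le_div_right ?_ _),
        h1.trans (ENNReal.div_le_div_right (hHn _) _)⟩
      rw [Set.image_comp]
      exact hH _
  · refine DensityMetric.Weight.le_iSup_sublevelMinus hρ hΩ
      (fun _ _ h => DensityMetric.dimP_mono h)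
      (D' := DensityMetric.dimP) (fun _ _ h => DensityMetric.dimP_mono h)
      (fun A c h => DensityMetric.dimP_iUnion_le A h) fun κ P hκ h => ?_
    have h1 := h.dimP_le hκ
    rw [Set.image_id] at h1
    refine ⟨h1.trans (ENNReal.div_le_div_right ?_ _),
      h1.trans (ENNReal.div_le_div_right (hPn _) _)⟩
    rw [Set.image_comp]
    exact hP _
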